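/- Let $d\ge 1$, let $\sigma$ be the surface measure on $\mathbb S^{d-1}\subset\mathbb R^d$ (counting measure on $\{\pm1\}$ if $d=1$), and for every $n\ge 0$ let $\{Y^n_\ell : 1\le \ell\le a_n^d\}$ be a real basis of the space of harmonic homogeneous polynomials of degree $n$ in $d$ variables (which has dimension $a_n^d$) that is orthonormal in $L^2(\mathbb S^{d-1},\sigma)$. For $\nu\ge -\frac12$ let $$J_\nu(z)=\sum_{m\ge 0}\frac{(-1)^m}{m!\,\Gamma(m+\nu+1)}\Big(\frac z2\Big)^{2m+\nu},\qquad \mathscr H^d_\nu[g](\rho)=\int_0^\infty J_\nu(\rho r)\,g(r)\,r^{d/2}\,dr .$$ For $f\in L^2(\mathbb R^d;\mathbb C)$ put $f^n_\ell(r)=\int_{\mathbb S^{d-1}} f(r\hat x)\,Y^n_\ell(\hat x)\,d\sigma(\hat x)$, and let $\mathscr F[f](\xi)=\int_{\mathbb R^d} f(x)e^{-i\langle \xi,x\rangle}\,dx$ be the Fourier transform, extended continuously to $L^2(\mathbb R^d)$. Then, for every $f\in L^2(\mathbb R^d;\mathbb C)$: 1. For all $n,\ell$ the transform $\mathscr H^d_{n+\frac{d-2}2}[f^n_\ell]$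 exists in the $L^2$ sense, that is, the integrals over $(0,R)$ converge in $L^2((0,\infty),\rho\,d\rho)$ as $R\to\infty$. 2. With $\xi=\rho\hat\xi$, $\rho=\|\xi\|$, $\hat\xi\in\mathbb S^{d-1}$, $$\mathscr F[f](\rho\hat\xi)=\sum_{n=0}^\infty \frac{(2\pi)^{d/2}(-i)^n}{\rho^{(d-2)/2}}\sum_{\ell=1}^{a_n^d} Y^n_\ell(\hat\xi)\,\mathscr H^d_{n+\frac{d-2}2}[f^n_\ell](\rho),$$ where the series over $n$ converges in $L^2(\mathbb R^d)$ and the Hankel transforms are those of item 1. 3. If moreover $f\in L^1(\mathbb R^d)$, then for every $\rho>0$ the integrals defining $\mathscr H^d_{n+\frac{d-2}2}[f^n_\ell](\rho)$ converge absolutely, and the formula of item 2, with all transforms given by these Lebesgue integrals, holds with convergence of the series over $n$ in $L^2(\mathbb S^{d-1},\sigma)$ with respect to $\hat\xi$. -/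

import Mathlib

open MeasureTheory

noncomputable section

namespace FourierHankel

/-- The Euclidean space `ℝ^d`. -/
abbrev E (d : ℕ) : Type := EuclideanSpace ℝ (Fin d)

/-- The unit sphere `𝕊^{d-1}` of `ℝ^d`. -/
abbrev S (d : ℕ) : Type := Metric.sphere (0 : E d) 1

/-- The surface measure of `𝕊^{d-1}` (counting measure on `{-1, 1}` for `d = 1`). -/
def surf (d : ℕ) : Measure (S d) := (volume : Measure (E d)).toSphere

/-- The Laplace operator on real polynomials in `d` variables. -/
def lap (d : ℕ) : MvPolynomial (Fin d) ℝ →ₗ[ℝ] MvPolynomial (Fin d) ℝ :=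
  ∑ i : Fin d, (MvPolynomial.pderiv i).toLinearMap ∘ₗ (MvPolynomial.pderiv i).toLinearMap

/-- The space `𝓗_n^d` of harmonic polynomials of degree `n`: the homogeneous polynomials of
degree `n` in `d` variables that satisfy the Laplace equation. -/
def harm (d n : ℕ) : Submodule ℝ (MvPolynomial (Fin d) ℝ) :=
  MvPolynomial.homogeneousSubmodule (Fin d) ℝ n ⊓ LinearMap.ker (lap d)

/-- The dimension `a_n^d` of `𝓗_n^d`. -/
def dimHarm (d n : ℕ) : ℕ := Module.finrank ℝ (harm d n)

/-- The value of a polynomial at a point of `ℝ^d`; on the unit sphere, a harmonic polynomial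
gives the corresponding spherical harmonic. -/
def ev {d : ℕ} (p : MvPolynomial (Fin d) ℝ) (x : E d) : ℝ :=
  MvPolynomial.eval (fun i => x i) p

/-- A choice of a real orthonormal basis `Y_ℓ^n`, `1 ≤ ℓ ≤ a_n^d`, of `𝓗_n^d` for every `n`; the
inner product is that of `L²(𝕊^{d-1})`. -/
structure OrthonormalHarmonics (d : ℕ) where
  basis : ∀ n : ℕ, Module.Basis (Fin (dimHarm d n)) ℝ (harm d n)
  orthonormal : ∀ (n : ℕ) (l m : Fin (dimHarm d n)),
    ∫ x : S d, ev (basis n l : MvPolynomial (Fin d) ℝ) x.1 *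
      ev (basis n m : MvPolynomial (Fin d) ℝ) x.1 ∂(surf d) = if l = m then 1 else 0

/-- The function `Y_ℓ^n` (evaluated below at points of the unit sphere). -/
def OrthonormalHarmonics.Y {d : ℕ} (B : OrthonormalHarmonics d) (n : ℕ)
    (l : Fin (dimHarm d n)) (x : E d) : ℝ :=
  ev (B.basis n l : MvPolynomial (Fin d) ℝ) x

/-- The radial coefficient `f_ℓ^n(r) = ∫_{𝕊^{d-1}} f(r x̂) Y_ℓ^n(x̂) dσ(x̂)`. -/
def OrthonormalHarmonics.coeff {d : ℕ} (B : OrthonormalHarmonics d) (f : E d → ℂ) (n : ℕ)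
    (l : Fin (dimHarm d n)) (r : ℝ) : ℂ :=
  ∫ x : S d, f (r • x.1) * (B.Y n l x.1 : ℂ) ∂(surf d)

/-- The Bessel function of the first kind `J_ν(z)` for real order `ν ≥ -1/2` and `z > 0`. -/
def besselJ (ν z : ℝ) : ℝ :=
  ∑' m : ℕ, (-1 : ℝ) ^ m / ((m.factorial : ℝ) * Real.Gamma (m + ν + 1)) *
    (z / 2) ^ (2 * (m : ℝ) + ν)

/-- The integrand `J_ν(ρ r) g(r) r^{d/2}` of the Hankel transform. -/
def hankelIntegrand (d : ℕ) (ν : ℝ) (g : ℝ → ℂ) (ρ r : ℝ) : ℂ :=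
  (besselJ ν (ρ * r) : ℂ) * g r * ((r ^ ((d : ℝ) / 2) : ℝ) : ℂ)

/-- The Hankel transform `∫_0^∞ J_ν(ρ r) g(r) r^{d/2} dr`, as a Lebesgue integral. -/
def hankelIntegral (d : ℕ) (ν : ℝ) (g : ℝ → ℂ) (ρ : ℝ) : ℂ :=
  ∫ r in Set.Ioi (0 : ℝ), hankelIntegrand d ν g ρ r

/-- The measure `ρ dρ` on `(0, ∞)`. -/
def radial : Measure ℝ :=
  (volume.restrict (Set.Ioi (0 : ℝ))).withDensity (fun ρ => ENNReal.ofReal ρ)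

/-- `h` is the `L²` Hankel transform of `g`: the integral over `(0, ∞)` is understood as the limit
of the integrals over `(0, R)` as `R → ∞`, in the norm of `L²((0, ∞), ρ dρ)`. This determines `h`
almost everywhere. (For `g` in `L²((0, ∞), r^{d-1} dr)` the integral over `(0, ∞)` need not
converge absolutely.) -/
def IsHankelTransform (d : ℕ) (ν : ℝ) (g h : ℝ → ℂ) : Prop :=
  MemLp h 2 radial ∧
    Filter.Tendsto
      (fun R : ℝ => eLpNorm
        (fun ρ => hankelIntegral d ν ((Set.Iio R).indicator g) ρ - h ρ) 2 radial)
      Filter.atTop (nhds 0)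

/-- The Fourier transform `∫ f(x) e^{-i⟨ξ, x⟩} dx`, as a Lebesgue integral. -/
def fourierIntegral {d : ℕ} (f : E d → ℂ) (ξ : E d) : ℂ :=
  ∫ x, f x * Complex.exp (-Complex.I * ((inner ℝ ξ x : ℝ) : ℂ))

/-- The Fourier transform on `L²(ℝ^d)` (the continuous extension from integrable functions), in the
normalization `∫ f(x) e^{-i⟨ξ, x⟩} dx`. Mathlib's transform has the kernel `e^{-2πi⟨ξ, x⟩}`, hence
the rescaling. -/
def fourierL2 {d : ℕ} (f : E d → ℂ) (hf : MemLp f 2 volume) (ξ : E d) : ℂ :=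
  (FourierTransform.fourier (hf.toLp f) : Lp (α := E d) ℂ 2) ((2 * Real.pi)⁻¹ • ξ)

/-- The order `n + (d-2)/2`. -/
def order (d n : ℕ) : ℝ := (n : ℝ) + ((d : ℝ) - 2) / 2

/-- The `n`-th term
`(2π)^{d/2} (-i)^n / ρ^{(d-2)/2} * ∑_ℓ Y_ℓ^n(ξ̂) h_ℓ^n(ρ)` of the series. -/
def seriesTerm {d : ℕ} (B : OrthonormalHarmonics d) (h : ∀ n : ℕ, Fin (dimHarm d n) → ℝ → ℂ)
    (n : ℕ) (ρ : ℝ) (ξ : E d) : ℂ :=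
  (((2 * Real.pi) ^ ((d : ℝ) / 2) : ℝ) : ℂ) * (-Complex.I) ^ n /
      ((ρ ^ (((d : ℝ) - 2) / 2) : ℝ) : ℂ) *
    ∑ l : Fin (dimHarm d n), (B.Y n l ξ : ℂ) * h n l ρ

end FourierHankel

end

/-!
The formula rests on two facts about spherical harmonics.

*The Fourier transform of a spherical harmonic.* For `u` harmonic and homogeneous of degree `n` and
`|ξ| = 1`, `integral_sphere_harm_mul_exp` evaluates `∫ u(ω) e^{-it⟨ξ, ω⟩} dσ(ω)` as
`(2π)^{d/2} (-i)^n t^{-(d-2)/2} J_{n+(d-2)/2}(t) u(ξ)`. The exponential is expanded in powers of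
`⟨ξ, ω⟩`, so that only the moments `∫ u ⟨ξ, ·⟩^k dσ` are needed. On homogeneous polynomials,
integration over the sphere is a multiple of the Gaussian functional `L(p) = ∫ p(x) e^{-|x|²} dx`
(`gauss_eq_integral_sphere`), for which integration by parts is purely algebraic:
`L(∂_i q) = 2 L(x_i q)`. With Euler's identity this gives Green's identity `gauss_mul_lap_sub`,
hence the orthogonality of a harmonic polynomial to everything of smaller degree, and
`L(Δq) = 2m L(q)` in degree `m`. Applied to `q = u ⟨ξ, ·⟩^k` the last relation is a recursion for
the moments: they vanish unless `k = n + 2m`, and in that case they are the coefficients of the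
Bessel series (`gauss_harm_mul_linForm_pow`).

*Completeness.* If `|x|² q` is harmonic then it is orthogonal to `q`, so `q = 0`; by finite
dimension every homogeneous polynomial is `h + |x|² q` with `h` harmonic, and on the sphere every
polynomial is a sum of harmonics. By the Stone–Weierstrass theorem the `Y_ℓ^n` form a Hilbert basis
of `L²` of the sphere (`OrthonormalHarmonics.hilbertBasis`).

For integrable `f`, Fubini's theorem and polar coordinates turn the first fact into
`sphCoeff_fourierIntegral`: the coefficients of the continuous function `ω ↦ 𝓕f(ρω)` are the Hankel
transforms of the `f_ℓ^n`, up to the factor `(2π)^{d/2} (-i)^n ρ^{-(d-2)/2}`. The series is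
therefore the expansion of `𝓕f(ρ ·)` in the Hilbert basis. The same fact shows that
`t^{-(d-2)/2} J(t)` is bounded, whence the absolute convergence of the integrals.

For square-integrable `f`, every function in `L²(ℝ^d)`, in particular `𝓕f`, is the sum of its
expansion (`tendsto_eLpNorm_sub_seriesTerm`), and it remains to recognize its coefficients. The
truncation of `f` to the ball of radius `R` is integrable, its Fourier transform converges to `𝓕f`
by Plancherel's theorem, and taking coefficients is a contraction on `L²`; so the truncated Hankel
integrals converge in `L²(ρ dρ)` to a multiple of the coefficients of `𝓕f`
(`isHankelTransform_hankelL2`).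
-/

noncomputable section

namespace FourierHankel

open Filter Topology

variable {d : ℕ}

/-! ### Polar coordinates -/

/-- The measure `r^{d-1} dr` on `(0, ∞)`. -/
def rad (d : ℕ) : Measure ℝ :=
  (volume.restrict (Set.Ioi (0 : ℝ))).withDensity (fun r => ENNReal.ofReal (r ^ (d - 1)))

instance (d : ℕ) : SigmaFinite (rad d) :=
  SigmaFinite.withDensity_of_ne_top' (fun _ => ENNReal.ofReal_ne_top)

instance (d : ℕ) : IsFiniteMeasure (surf d) := by
  unfold surf; infer_instance

lemma map_val_volumeIoiPow (n : ℕ) :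
    (Measure.volumeIoiPow n).map Subtype.val =
      (volume.restrict (Set.Ioi (0 : ℝ))).withDensity (fun r => ENNReal.ofReal (r ^ n)) := by
  have he : MeasurableEmbedding (Subtype.val : Set.Ioi (0 : ℝ) → ℝ) :=
    .subtype_coe measurableSet_Ioi
  ext s hs
  rw [Measure.map_apply measurable_subtype_coe hs, Measure.volumeIoiPow,
    withDensity_apply _ (measurable_subtype_coe hs), withDensity_apply _ hs,
    ← map_comap_subtype_coe measurableSet_Ioi, setLIntegral_map hs (by fun_prop)
      measurable_subtype_coe]

/-- Polar coordinates: `(r, ω) ↦ r ω` transports `r^{d-1} dr ⊗ σ` to Lebesgue measure. -/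
lemma measurePreserving_polar (d : ℕ) [NeZero d] :
    MeasurePreserving (fun p : ℝ × S d => p.1 • (p.2 : E d)) ((rad d).prod (surf d)) volume := by
  have hd : Module.finrank ℝ (E d) = d := by simp
  have h1 := (volume : Measure (E d)).measurePreserving_homeomorphUnitSphereProd.symm
    (homeomorphUnitSphereProd (E d)).toMeasurableEquiv
  rw [hd] at h1
  have h2 : MeasurePreserving (Subtype.val : ({0}ᶜ : Set (E d)) → E d)
      ((volume : Measure (E d)).comap Subtype.val) volume := by
    refine ⟨measurable_subtype_coe, ?_⟩
    rw [map_comap_subtype_coe (measurableSet_singleton _).compl, restrict_compl_singleton]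
  have h3 := h2.comp h1
  have h4 : MeasurePreserving (Subtype.val : Set.Ioi (0 : ℝ) → ℝ)
      (Measure.volumeIoiPow (d - 1)) (rad d) := ⟨measurable_subtype_coe, map_val_volumeIoiPow _⟩
  have h5 := (MeasurePreserving.id (surf d)).prod h4
  have h6 : MeasurePreserving (fun p : S d × ℝ => p.2 • (p.1 : E d)) ((surf d).prod (rad d))
      volume := by
    refine ⟨by fun_prop, ?_⟩
    rw [← h5.map_eq, Measure.map_map (by fun_prop) h5.measurable]
    exact h3.map_eq
  exact h6.comp Measure.measurePreserving_swap

lemma ae_rad_iff {d : ℕ} {p : ℝ → Prop} :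
    (∀ᵐ r ∂(rad d), p r) ↔ ∀ᵐ r ∂(volume : Measure ℝ), 0 < r → p r := by
  rw [rad, ae_withDensity_iff (by fun_prop), ae_restrict_iff' measurableSet_Ioi]
  refine eventually_congr (Eventually.of_forall fun r => ?_)
  refine forall_congr' fun hr => ?_
  have : ENNReal.ofReal (r ^ (d - 1)) ≠ 0 := by
    simpa using pow_pos (show 0 < r from hr) (d - 1)
  exact ⟨fun h => h this, fun h _ => h⟩

lemma ae_rad_of_pos {d : ℕ} {p : ℝ → Prop} (h : ∀ r, 0 < r → p r) : ∀ᵐ r ∂(rad d), p r :=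
  ae_rad_iff.2 (Eventually.of_forall h)

lemma integral_rad {F : Type*} [NormedAddCommGroup F] [NormedSpace ℝ F] (d : ℕ) (g : ℝ → F) :
    ∫ r, g r ∂(rad d) = ∫ r in Set.Ioi (0 : ℝ), r ^ (d - 1) • g r := by
  rw [rad, integral_withDensity_eq_integral_toReal_smul (by fun_prop) (by simp)]
  refine setIntegral_congr_fun measurableSet_Ioi fun r hr => ?_
  rw [ENNReal.toReal_ofReal (pow_nonneg (le_of_lt hr) _)]

lemma integrable_rad_iff {F : Type*} [NormedAddCommGroup F] [NormedSpace ℝ F] {d : ℕ}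
    {g : ℝ → F} :
    Integrable g (rad d) ↔ IntegrableOn (fun r => r ^ (d - 1) • g r) (Set.Ioi (0 : ℝ)) := by
  rw [rad, integrable_withDensity_iff_integrable_smul' (by fun_prop) (by simp), IntegrableOn]
  refine integrable_congr ?_
  filter_upwards [ae_restrict_mem measurableSet_Ioi] with r hr
  rw [ENNReal.toReal_ofReal (pow_nonneg (le_of_lt hr) _)]

lemma norm_sphere {d : ℕ} (ω : S d) : ‖(ω : E d)‖ = 1 := by simp

lemma norm_smul_sphere {d : ℕ} {r : ℝ} (hr : 0 < r) (ω : S d) : ‖r • (ω : E d)‖ = r := by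
  rw [norm_smul, norm_sphere, mul_one, Real.norm_of_nonneg hr.le]

/-! ### Polynomial functions -/

@[simp] lemma ev_add (p q : MvPolynomial (Fin d) ℝ) (x : E d) : ev (p + q) x = ev p x + ev q x := by
  simp [ev]

@[simp] lemma ev_mul (p q : MvPolynomial (Fin d) ℝ) (x : E d) : ev (p * q) x = ev p x * ev q x := by
  simp [ev]

@[simp] lemma ev_pow (p : MvPolynomial (Fin d) ℝ) (n : ℕ) (x : E d) :
    ev (p ^ n) x = ev p x ^ n := by
  simp [ev]

@[simp] lemma ev_C (a : ℝ) (x : E d) : ev (MvPolynomial.C a) x = a := by simp [ev]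

@[simp] lemma ev_one (x : E d) : ev (1 : MvPolynomial (Fin d) ℝ) x = 1 := by simp [ev]

@[simp] lemma ev_zero (x : E d) : ev (0 : MvPolynomial (Fin d) ℝ) x = 0 := by simp [ev]

@[simp] lemma ev_sum {ι : Type*} (s : Finset ι) (p : ι → MvPolynomial (Fin d) ℝ) (x : E d) :
    ev (∑ i ∈ s, p i) x = ∑ i ∈ s, ev (p i) x := by
  simp [ev]

@[simp] lemma ev_X (i : Fin d) (x : E d) : ev (MvPolynomial.X i) x = x i := by simp [ev]

@[simp] lemma ev_smul (a : ℝ) (p : MvPolynomial (Fin d) ℝ) (x : E d) :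
    ev (a • p) x = a * ev p x := by
  simp [ev]

lemma continuous_ev (p : MvPolynomial (Fin d) ℝ) : Continuous (ev p : E d → ℝ) :=
  (MvPolynomial.continuous_eval p).comp (by fun_prop)

lemma ev_smul_arg {p : MvPolynomial (Fin d) ℝ} {n : ℕ} (hp : p.IsHomogeneous n) (r : ℝ) (x : E d) :
    ev p (r • x) = r ^ n * ev p x := by
  simp only [ev, MvPolynomial.eval_eq', Finset.mul_sum]
  refine Finset.sum_congr rfl fun m hm => ?_
  have hdeg : ∑ i, m i = n := by
    rw [← hp (MvPolynomial.mem_support_iff.1 hm), Finsupp.weight_apply, Finsupp.sum_fintype] <;>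
      simp
  simp only [PiLp.smul_apply, smul_eq_mul, mul_pow, Finset.prod_mul_distrib,
    Finset.prod_pow_eq_pow_sum, hdeg]
  ring

lemma hasLineDerivAt_ev (p : MvPolynomial (Fin d) ℝ) (x : E d) (i : Fin d) :
    HasLineDerivAt ℝ (ev p) (ev (MvPolynomial.pderiv i p) x) x (EuclideanSpace.single i 1) := by
  induction p using MvPolynomial.induction_on with
  | C a => simpa [HasLineDerivAt] using hasDerivAt_const (0 : ℝ) a
  | add p q hp hq =>
    simp only [HasLineDerivAt, map_add, ev_add] at hp hq ⊢
    exact hp.add hq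
  | mul_X p j hp =>
    have hj : HasDerivAt (fun t : ℝ => (x + t • EuclideanSpace.single i (1 : ℝ) : E d) j)
        (if i = j then 1 else 0) 0 := by
      by_cases h : i = j
      · subst h
        simpa using (hasDerivAt_id (0 : ℝ)).const_add (x i)
      · simpa [h, Ne.symm h] using hasDerivAt_const (0 : ℝ) (x j)
    simp only [HasLineDerivAt, ev_mul, ev_X] at hp ⊢
    refine (hp.mul hj).congr_deriv ?_
    by_cases h : i = j
    · subst h; simp [Derivation.leibniz]; ring
    · simp [h, Derivation.leibniz, MvPolynomial.pderiv_X_of_ne (Ne.symm h)]; ring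

lemma integrable_norm_pow_mul_gaussian [NeZero d] (k : ℕ) :
    Integrable (fun x : E d => ‖x‖ ^ k * Real.exp (-‖x‖ ^ 2)) := by
  rw [integrable_fun_norm_addHaar volume (f := fun r => r ^ k * Real.exp (-r ^ 2))]
  have h := integrableOn_rpow_mul_exp_neg_mul_sq one_pos
    (s := ((d - 1 + k : ℕ) : ℝ)) (by have : (0:ℝ) ≤ (d - 1 + k : ℕ) := by positivity
                                     linarith)
  refine h.congr_fun (fun r _ => ?_) measurableSet_Ioi
  simp only [Real.rpow_natCast, pow_add, mul_assoc, smul_eq_mul, neg_mul, one_mul,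
    finrank_euclideanSpace, Fintype.card_fin]

/-- Every polynomial is integrable against the Gaussian; the power of `|x|` makes the induction on
the polynomial go through. -/
lemma integrable_norm_pow_mul_ev_mul_gaussian [NeZero d] (p : MvPolynomial (Fin d) ℝ) :
    ∀ k : ℕ, Integrable (fun x : E d => ‖x‖ ^ k * ev p x * Real.exp (-‖x‖ ^ 2)) := by
  have hc (p : MvPolynomial (Fin d) ℝ) := continuous_ev p
  induction p using MvPolynomial.induction_on with
  | C a =>
    intro k
    refine ((integrable_norm_pow_mul_gaussian (d := d) k).const_mul a).congr ?_
    exact Eventually.of_forall fun x => by simp only [ev_C]; ring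
  | add p q hp hq =>
    intro k
    refine ((hp k).add (hq k)).congr ?_
    exact Eventually.of_forall fun x => by simp only [Pi.add_apply, ev_add]; ring
  | mul_X p j hp =>
    intro k
    refine (hp (k + 1)).mono ?_ (Eventually.of_forall fun x => ?_)
    · have := hc (p * MvPolynomial.X j)
      exact Continuous.aestronglyMeasurable (by fun_prop)
    · have hx : ‖x j‖ ≤ ‖x‖ := PiLp.norm_apply_le x j
      simp only [norm_mul, ev_mul, ev_X, norm_pow, norm_norm, pow_succ]
      calc ‖x‖ ^ k * (‖ev p x‖ * ‖x j‖) * ‖Real.exp (-‖x‖ ^ 2)‖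
          = (‖x‖ ^ k * ‖ev p x‖ * ‖Real.exp (-‖x‖ ^ 2)‖) * ‖x j‖ := by ring
        _ ≤ (‖x‖ ^ k * ‖ev p x‖ * ‖Real.exp (-‖x‖ ^ 2)‖) * ‖x‖ := by gcongr
        _ = _ := by ring_nf

lemma integrable_ev_mul_gaussian [NeZero d] (p : MvPolynomial (Fin d) ℝ) :
    Integrable (fun x : E d => ev p x * Real.exp (-‖x‖ ^ 2)) := by
  simpa using integrable_norm_pow_mul_ev_mul_gaussian p 0

/-! ### The Gaussian functional and harmonic polynomials -/

/-- The Gaussian functional `p ↦ ∫ p(x) e^{-|x|²} dx` on polynomials. -/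
def gauss (d : ℕ) [NeZero d] : MvPolynomial (Fin d) ℝ →ₗ[ℝ] ℝ where
  toFun p := ∫ x : E d, ev p x * Real.exp (-‖x‖ ^ 2)
  map_add' p q := by
    rw [← integral_add (integrable_ev_mul_gaussian p) (integrable_ev_mul_gaussian q)]
    simp only [ev_add, add_mul]
  map_smul' a p := by
    simp only [ev_smul, mul_assoc, integral_const_mul, smul_eq_mul, RingHom.id_apply]

lemma gauss_apply [NeZero d] (p : MvPolynomial (Fin d) ℝ) :
    gauss d p = ∫ x : E d, ev p x * Real.exp (-‖x‖ ^ 2) := rfl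

/-- Integration by parts against the Gaussian. -/
lemma gauss_pderiv [NeZero d] (i : Fin d) (q : MvPolynomial (Fin d) ℝ) :
    gauss d (MvPolynomial.pderiv i q) = 2 * gauss d (MvPolynomial.X i * q) := by
  have hg (x : E d) : HasLineDerivAt ℝ (fun x : E d => Real.exp (-‖x‖ ^ 2))
      (-(2 * x i) * Real.exp (-‖x‖ ^ 2)) x (EuclideanSpace.single i 1) := by
    have h1 : HasFDerivAt (fun x : E d => Real.exp (-‖x‖ ^ 2)) _ x :=
      (((hasStrictFDerivAt_norm_sq x).hasFDerivAt).neg).exp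
    refine HasDerivAt.congr_deriv (h1.hasLineDerivAt (EuclideanSpace.single i 1)) ?_
    simp [EuclideanSpace.inner_single_right]
    ring
  have key := integral_bilinear_hasLineDerivAt_right_eq_neg_left_of_integrable
    (μ := (volume : Measure (E d))) (v := EuclideanSpace.single i 1)
    (f := ev q) (f' := ev (MvPolynomial.pderiv i q)) (g := fun x : E d => Real.exp (-‖x‖ ^ 2))
    (g' := fun x : E d => -(2 * x i) * Real.exp (-‖x‖ ^ 2))
    (B := ContinuousLinearMap.mul ℝ ℝ) (integrable_ev_mul_gaussian _)
    (((integrable_ev_mul_gaussian (MvPolynomial.X i * q)).const_mul (-2)).congr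
      (Eventually.of_forall fun x => by simp; ring))
    (integrable_ev_mul_gaussian _) (fun x _ => hasLineDerivAt_ev q x i) (fun x _ => hg x)
  simp only [ContinuousLinearMap.mul_apply'] at key
  rw [gauss_apply, gauss_apply, ← integral_const_mul]
  rw [← neg_eq_iff_eq_neg] at key
  rw [← key, ← integral_neg]
  refine integral_congr_ae (Eventually.of_forall fun x => ?_)
  simp
  ring

lemma lap_apply (p : MvPolynomial (Fin d) ℝ) :
    lap d p = ∑ i, MvPolynomial.pderiv i (MvPolynomial.pderiv i p) := by
  simp [lap]

/-- Green's identity for the Gaussian weight: the terms from differentiating the weight are radial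
derivatives, which by Euler's identity become the degrees. -/
lemma gauss_mul_lap_sub [NeZero d] {p q : MvPolynomial (Fin d) ℝ} {n m : ℕ}
    (hp : p.IsHomogeneous n) (hq : q.IsHomogeneous m) :
    gauss d (p * lap d q) - gauss d (q * lap d p) = 2 * ((m : ℝ) - n) * gauss d (p * q) := by
  have h1 : p * lap d q - q * lap d p =
      ∑ i, MvPolynomial.pderiv i (p * MvPolynomial.pderiv i q - q * MvPolynomial.pderiv i p) := by
    rw [lap_apply, lap_apply, Finset.mul_sum, Finset.mul_sum, ← Finset.sum_sub_distrib]
    refine Finset.sum_congr rfl fun i _ => ?_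
    simp only [map_sub, Derivation.leibniz, smul_eq_mul]
    ring
  have h2 : ∑ i, MvPolynomial.X i *
      (p * MvPolynomial.pderiv i q - q * MvPolynomial.pderiv i p) = ((m : ℝ) - n) • (p * q) := by
    have e1 := hp.sum_X_mul_pderiv
    have e2 := hq.sum_X_mul_pderiv
    calc _ = p * ∑ i, MvPolynomial.X i * MvPolynomial.pderiv i q -
          q * ∑ i, MvPolynomial.X i * MvPolynomial.pderiv i p := by
          rw [Finset.mul_sum, Finset.mul_sum, ← Finset.sum_sub_distrib]
          exact Finset.sum_congr rfl fun i _ => by ring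
      _ = _ := by
          rw [e1, e2, sub_smul, Nat.cast_smul_eq_nsmul, Nat.cast_smul_eq_nsmul]
          simp only [nsmul_eq_mul]
          ring
  rw [← map_sub, h1, map_sum, Finset.sum_congr rfl fun i _ => gauss_pderiv i _, ← Finset.mul_sum,
    ← map_sum, h2, map_smul, smul_eq_mul, mul_assoc]

lemma isHomogeneous_lap {q : MvPolynomial (Fin d) ℝ} {m : ℕ} (hq : q.IsHomogeneous m) :
    (lap d q).IsHomogeneous (m - 2) := by
  rw [lap_apply]
  exact MvPolynomial.IsHomogeneous.sum _ _ _ fun i _ => hq.pderiv.pderiv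

lemma lap_eq_zero_of_lt_two {q : MvPolynomial (Fin d) ℝ} {m : ℕ} (hq : q.IsHomogeneous m)
    (hm : m < 2) : lap d q = 0 := by
  rw [lap_apply]
  refine Finset.sum_eq_zero fun i _ => ?_
  have h : (MvPolynomial.pderiv i q).IsHomogeneous 0 := by
    have := hq.pderiv (i := i)
    rwa [show m - 1 = 0 by omega] at this
  rw [← MvPolynomial.totalDegree_zero_iff_isHomogeneous,
    MvPolynomial.totalDegree_eq_zero_iff_eq_C] at h
  rw [h, MvPolynomial.pderiv_C]

lemma gauss_lap [NeZero d] {q : MvPolynomial (Fin d) ℝ} {m : ℕ} (hq : q.IsHomogeneous m) :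
    gauss d (lap d q) = 2 * m * gauss d q := by
  have h := gauss_mul_lap_sub (MvPolynomial.isHomogeneous_one (Fin d) ℝ) hq
  have h1 : lap d (1 : MvPolynomial (Fin d) ℝ) = 0 :=
    lap_eq_zero_of_lt_two (MvPolynomial.isHomogeneous_one _ _) two_pos
  simpa [h1] using h

lemma mem_harm {n : ℕ} {p : MvPolynomial (Fin d) ℝ} :
    p ∈ harm d n ↔ p.IsHomogeneous n ∧ lap d p = 0 := by
  simp [harm]

/-- A harmonic homogeneous polynomial is orthogonal to every homogeneous polynomial of smaller
degree. -/
lemma gauss_harm_mul_eq_zero [NeZero d] {n : ℕ} {p : MvPolynomial (Fin d) ℝ} (hp : p ∈ harm d n)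
    {m : ℕ} (hm : m < n) {q : MvPolynomial (Fin d) ℝ} (hq : q.IsHomogeneous m) :
    gauss d (p * q) = 0 := by
  induction m using Nat.strong_induction_on generalizing q with
  | _ m ih =>
    obtain ⟨hp1, hp2⟩ := mem_harm.1 hp
    have h := gauss_mul_lap_sub hp1 hq
    have h0 : gauss d (p * lap d q) = 0 := by
      rcases lt_or_ge m 2 with h2 | h2
      · rw [lap_eq_zero_of_lt_two hq h2]; simp
      · exact ih (m - 2) (by omega) (by omega) (isHomogeneous_lap hq)
    rw [h0, hp2, mul_zero, map_zero, sub_zero, eq_comm] at h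
    have : (m : ℝ) - n ≠ 0 := sub_ne_zero.2 (by exact_mod_cast hm.ne)
    simpa [this] using h

/-- On homogeneous polynomials the Gaussian functional is a multiple of integration over the
sphere. -/
lemma gauss_eq_integral_sphere [NeZero d] {p : MvPolynomial (Fin d) ℝ} {n : ℕ}
    (hp : p.IsHomogeneous n) :
    gauss d p = Real.Gamma (((n : ℝ) + d) / 2) / 2 * ∫ ω : S d, ev p ω.1 ∂(surf d) := by
  have hP := measurePreserving_polar d
  have hI := integrable_ev_mul_gaussian p
  have h1 : gauss d p = ∫ z : ℝ × S d, ev p (z.1 • (z.2 : E d)) *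
      Real.exp (-‖z.1 • (z.2 : E d)‖ ^ 2) ∂((rad d).prod (surf d)) := by
    rw [gauss_apply, ← hP.map_eq, integral_map hP.measurable.aemeasurable]
    rw [hP.map_eq]; exact hI.aestronglyMeasurable
  have h2 := (hP.integrable_comp hI.aestronglyMeasurable).2 hI
  have hd1 : 1 ≤ d := NeZero.one_le
  rw [h1, integral_prod _ (by exact h2), integral_rad]
  have h3 : ∀ r ∈ Set.Ioi (0 : ℝ), (r ^ (d - 1) • ∫ ω : S d, ev p (r • (ω : E d)) *
      Real.exp (-‖r • (ω : E d)‖ ^ 2) ∂(surf d)) =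
      (r ^ ((n : ℝ) + d - 1) * Real.exp (-r ^ (2 : ℝ))) * ∫ ω : S d, ev p ω.1 ∂(surf d) := by
    intro r hr
    simp only [norm_smul_sphere hr, ev_smul_arg hp, smul_eq_mul]
    rw [← integral_const_mul, ← integral_const_mul]
    refine integral_congr_ae (Eventually.of_forall fun ω => ?_)
    have : r ^ ((n : ℝ) + d - 1) = r ^ (d - 1) * r ^ n := by
      rw [show (n : ℝ) + d - 1 = ((d - 1 + n : ℕ) : ℝ) by push_cast [Nat.cast_sub hd1]; ring,
        Real.rpow_natCast, pow_add]
    simp only [this, Real.rpow_two]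
    ring
  rw [setIntegral_congr_fun measurableSet_Ioi h3, integral_mul_const,
    integral_rpow_mul_exp_neg_rpow two_pos]
  · ring_nf
  · have : (1 : ℝ) ≤ d := by exact_mod_cast hd1
    have : (0 : ℝ) ≤ n := by positivity
    linarith

lemma gauss_one [NeZero d] : gauss d 1 = Real.pi ^ ((d : ℝ) / 2) := by
  have := GaussianFourier.integral_rexp_neg_mul_sq_norm (V := E d) one_pos
  simpa [gauss_apply] using this

/-! ### Moments of a spherical harmonic against powers of a linear form -/

/-- The linear form `x ↦ ⟨ξ, x⟩` as a polynomial. -/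
def linForm (ξ : E d) : MvPolynomial (Fin d) ℝ :=
  ∑ i, MvPolynomial.C (ξ i) * MvPolynomial.X i

/-- The derivative of a polynomial in the direction `ξ`. -/
def dirDeriv (ξ : E d) (u : MvPolynomial (Fin d) ℝ) : MvPolynomial (Fin d) ℝ :=
  ∑ i, MvPolynomial.C (ξ i) * MvPolynomial.pderiv i u

lemma ev_linForm (ξ x : E d) : ev (linForm ξ) x = inner ℝ ξ x := by
  simp [linForm, PiLp.inner_apply, mul_comm]

lemma isHomogeneous_linForm (ξ : E d) : (linForm ξ).IsHomogeneous 1 :=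
  MvPolynomial.IsHomogeneous.sum _ _ _ fun _ _ => MvPolynomial.isHomogeneous_C_mul_X _ _

lemma pderiv_linForm (ξ : E d) (i : Fin d) :
    MvPolynomial.pderiv i (linForm ξ) = MvPolynomial.C (ξ i) := by
  simp only [linForm, map_sum, Derivation.leibniz, MvPolynomial.pderiv_C, MvPolynomial.pderiv_X,
    smul_eq_mul]
  rw [Finset.sum_eq_single i] <;> simp +contextual [eq_comm]

lemma pderiv_comm (i j : Fin d) (u : MvPolynomial (Fin d) ℝ) :
    MvPolynomial.pderiv i (MvPolynomial.pderiv j u) =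
      MvPolynomial.pderiv j (MvPolynomial.pderiv i u) := by
  have h : ⁅(MvPolynomial.pderiv i :
      Derivation ℝ (MvPolynomial (Fin d) ℝ) (MvPolynomial (Fin d) ℝ)),
      (MvPolynomial.pderiv j :
      Derivation ℝ (MvPolynomial (Fin d) ℝ) (MvPolynomial (Fin d) ℝ))⁆ = 0 := by
    refine MvPolynomial.derivation_ext fun k => ?_
    rw [Derivation.commutator_apply]
    simp [MvPolynomial.pderiv_X, Pi.single_apply, apply_ite]
  have h2 := congrArg (fun D => D u) h
  simpa [Derivation.commutator_apply, sub_eq_zero] using h2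

lemma dirDeriv_mem_harm {ξ : E d} {n : ℕ} {u : MvPolynomial (Fin d) ℝ} (hu : u ∈ harm d n) :
    dirDeriv ξ u ∈ harm d (n - 1) := by
  obtain ⟨h1, h2⟩ := mem_harm.1 hu
  refine mem_harm.2 ⟨MvPolynomial.IsHomogeneous.sum _ _ _ fun i _ => ?_, ?_⟩
  · simpa using (MvPolynomial.isHomogeneous_C (Fin d) (ξ i)).mul (h1.pderiv (i := i))
  · rw [dirDeriv, map_sum]
    refine Finset.sum_eq_zero fun i _ => ?_
    rw [← MvPolynomial.smul_eq_C_mul, map_smul, lap_apply,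
      Finset.sum_congr rfl fun j _ => by rw [pderiv_comm j i, pderiv_comm j i], ← map_sum,
      ← lap_apply, h2, map_zero, smul_zero]

lemma ev_dirDeriv_self {ξ : E d} {n : ℕ} {u : MvPolynomial (Fin d) ℝ} (hu : u.IsHomogeneous n) :
    ev (dirDeriv ξ u) ξ = n * ev u ξ := by
  have h := congrArg (fun p => ev p ξ) hu.sum_X_mul_pderiv
  simpa [dirDeriv, ← Nat.cast_smul_eq_nsmul ℝ] using h

/-- For a unit vector `ξ` the Laplacian of `u ⟨ξ, ·⟩^k` follows from Leibniz's rule, since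
`|∇⟨ξ, ·⟩| = 1`. -/
lemma lap_mul_linForm_pow {ξ : E d} (hξ : ‖ξ‖ = 1) (u : MvPolynomial (Fin d) ℝ) (k : ℕ) :
    lap d (u * linForm ξ ^ k) = lap d u * linForm ξ ^ k +
      (2 * k : ℝ) • (dirDeriv ξ u * linForm ξ ^ (k - 1)) +
      (k * (k - 1) : ℝ) • (u * linForm ξ ^ (k - 2)) := by
  have hone : ∑ i, (MvPolynomial.C (ξ i) : MvPolynomial (Fin d) ℝ) * MvPolynomial.C (ξ i) = 1 := by
    have := EuclideanSpace.real_norm_sq_eq ξ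
    rw [hξ, one_pow] at this
    rw [← MvPolynomial.C_1, this, map_sum]
    exact Finset.sum_congr rfl fun i _ => by rw [← map_mul, pow_two]
  have hC2 : (MvPolynomial.C 2 : MvPolynomial (Fin d) ℝ) = 2 := map_ofNat MvPolynomial.C 2
  have hi : ∀ i, MvPolynomial.pderiv i (MvPolynomial.pderiv i (u * linForm ξ ^ k)) =
      MvPolynomial.pderiv i (MvPolynomial.pderiv i u) * linForm ξ ^ k +
      (2 * k : ℝ) • ((MvPolynomial.C (ξ i) * MvPolynomial.pderiv i u) * linForm ξ ^ (k - 1)) +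
      (k * (k - 1) : ℝ) • ((MvPolynomial.C (ξ i) * MvPolynomial.C (ξ i)) *
        (u * linForm ξ ^ (k - 2))) := by
    intro i
    rcases k with _ | _ | k
    · simp
    · simp [Derivation.leibniz, pderiv_linForm, MvPolynomial.smul_eq_C_mul, hC2]
      ring
    · simp [Derivation.leibniz, Derivation.leibniz_pow, pderiv_linForm,
        MvPolynomial.smul_eq_C_mul, hC2]
      ring
  rw [lap_apply, Finset.sum_congr rfl fun i _ => hi i]
  simp only [Finset.sum_add_distrib, ← Finset.smul_sum, ← Finset.sum_mul, hone, ← lap_apply,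
    one_mul]
  rfl

/-- The recursion for the moments `∫ u ⟨ξ, ·⟩^k e^{-|x|²}` of a harmonic polynomial `u`. -/
lemma gauss_harm_mul_linForm_pow_rec [NeZero d] {ξ : E d} (hξ : ‖ξ‖ = 1) {a : ℕ}
    {u : MvPolynomial (Fin d) ℝ} (hu : u ∈ harm d a) (k : ℕ) :
    2 * ((a : ℝ) + k) * gauss d (u * linForm ξ ^ k) =
      2 * k * gauss d (dirDeriv ξ u * linForm ξ ^ (k - 1)) +
      k * (k - 1) * gauss d (u * linForm ξ ^ (k - 2)) := by
  obtain ⟨h1, h2⟩ := mem_harm.1 hu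
  have hk : (u * linForm ξ ^ k).IsHomogeneous (a + k) := by
    simpa using h1.mul ((isHomogeneous_linForm ξ).pow k)
  have h := gauss_lap hk
  rw [lap_mul_linForm_pow hξ, h2, zero_mul, zero_add, map_add, map_smul, map_smul] at h
  push_cast at h
  simpa using h.symm

/-- In odd degree, applying the Laplacian repeatedly leads to a linear form and then to zero. -/
lemma gauss_eq_zero_of_odd [NeZero d] {m : ℕ} (hm : Odd m) {q : MvPolynomial (Fin d) ℝ}
    (hq : q.IsHomogeneous m) : gauss d q = 0 := by
  induction m using Nat.strong_induction_on generalizing q with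
  | _ m ih =>
    have h := gauss_lap hq
    have h0 : gauss d (lap d q) = 0 := by
      rcases lt_or_ge m 2 with h2 | h2
      · rw [lap_eq_zero_of_lt_two hq h2]; simp
      · exact ih (m - 2) (by omega) (by rw [Nat.odd_iff] at hm ⊢; omega) (isHomogeneous_lap hq)
    rw [h0] at h
    have : (m : ℝ) ≠ 0 := by exact_mod_cast hm.pos.ne'
    simpa [this] using h.symm

/-- The nonzero moments. Solving the recursion ends at constants, and the directional derivatives
met on the way reproduce the value `u(ξ)` by Euler's identity. -/
lemma gauss_harm_mul_linForm_pow [NeZero d] {ξ : E d} (hξ : ‖ξ‖ = 1) (k : ℕ) :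
    ∀ (a m : ℕ), k = a + 2 * m → ∀ u ∈ harm d a, gauss d (u * linForm ξ ^ k) =
      Real.pi ^ ((d : ℝ) / 2) * k.factorial / (2 ^ k * m.factorial) * ev u ξ := by
  induction k using Nat.strong_induction_on with
  | _ k ih =>
  intro a m hk u hu
  rcases Nat.eq_zero_or_pos k with h0 | hpos
  · obtain ⟨rfl, rfl⟩ : a = 0 ∧ m = 0 := by omega
    subst h0
    have h1 := (mem_harm.1 hu).1
    rw [← MvPolynomial.totalDegree_zero_iff_isHomogeneous,
      MvPolynomial.totalDegree_eq_zero_iff_eq_C] at h1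
    rw [h1, pow_zero, mul_one, MvPolynomial.C_eq_smul_one, map_smul, gauss_one]
    simp [mul_comm]
  have hrec := gauss_harm_mul_linForm_pow_rec hξ hu k
  -- the term with the directional derivative
  have hA : k * gauss d (dirDeriv ξ u * linForm ξ ^ (k - 1)) =
      Real.pi ^ ((d : ℝ) / 2) * k.factorial / (2 ^ (k - 1) * m.factorial) * (a * ev u ξ) := by
    have hD := ev_dirDeriv_self (ξ := ξ) (mem_harm.1 hu).1
    rcases Nat.eq_zero_or_pos a with rfl | ha
    · have hz : dirDeriv ξ u = 0 := by
        have h1 := (mem_harm.1 hu).1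
        rw [← MvPolynomial.totalDegree_zero_iff_isHomogeneous,
          MvPolynomial.totalDegree_eq_zero_iff_eq_C] at h1
        rw [dirDeriv, h1]; simp
      simp [hz]
    · rw [ih (k - 1) (by omega) (a - 1) m (by omega) _ (dirDeriv_mem_harm hu), hD]
      obtain ⟨k, rfl⟩ : ∃ j, k = j + 1 := ⟨k - 1, by omega⟩
      simp only [Nat.add_sub_cancel, Nat.factorial_succ]
      push_cast
      ring
  -- the term in which the power drops by two
  have hB : k * (k - 1) * gauss d (u * linForm ξ ^ (k - 2)) =
      4 * m * (Real.pi ^ ((d : ℝ) / 2) * k.factorial / (2 ^ k * m.factorial) * ev u ξ) := by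
    rcases Nat.eq_zero_or_pos m with rfl | hm
    · rcases lt_or_ge k 2 with h2 | h2
      · obtain rfl : k = 1 := by omega
        simp
      · rw [gauss_harm_mul_eq_zero hu (m := k - 2) (by omega)
          (by simpa using (isHomogeneous_linForm ξ).pow (k - 2))]
        simp
    · rw [ih (k - 2) (by omega) a (m - 1) (by omega) _ hu]
      obtain ⟨k, rfl⟩ : ∃ j, k = j + 2 := ⟨k - 2, by omega⟩
      obtain ⟨m, rfl⟩ : ∃ j, m = j + 1 := ⟨m - 1, by omega⟩
      simp only [Nat.add_sub_cancel, Nat.factorial_succ]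
      push_cast
      field_simp
      ring
  have hne : 2 * ((a : ℝ) + k) ≠ 0 := by
    have : (0 : ℝ) < k := by exact_mod_cast hpos
    positivity
  refine mul_left_cancel₀ hne ?_
  rw [hrec, mul_assoc 2 (k : ℝ), hA, hB]
  obtain ⟨j, rfl⟩ : ∃ j, k = j + 1 := ⟨k - 1, by omega⟩
  have hj : ((j + 1 : ℕ) : ℝ) = a + 2 * m := by exact_mod_cast hk
  rw [hj, Nat.add_sub_cancel]
  field_simp
  ring

lemma integral_sphere_harm_mul_linForm_pow [NeZero d] {ξ : E d} (hξ : ‖ξ‖ = 1) {n : ℕ}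
    {u : MvPolynomial (Fin d) ℝ} (hu : u ∈ harm d n) (m : ℕ) :
    ∫ ω : S d, ev u ω.1 * (inner ℝ ξ (ω.1 : E d)) ^ (n + 2 * m) ∂(surf d) =
      2 * Real.pi ^ ((d : ℝ) / 2) * (n + 2 * m).factorial /
        (2 ^ (n + 2 * m) * m.factorial * Real.Gamma (n + m + d / 2)) * ev u ξ := by
  have h := gauss_harm_mul_linForm_pow hξ _ n m rfl u hu
  have hk : (u * linForm ξ ^ (n + 2 * m)).IsHomogeneous (n + (n + 2 * m)) := by
    simpa using (mem_harm.1 hu).1.mul ((isHomogeneous_linForm ξ).pow (n + 2 * m))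
  rw [gauss_eq_integral_sphere hk] at h
  have hG : (((n + (n + 2 * m) : ℕ) : ℝ) + d) / 2 = n + m + d / 2 := by push_cast; ring
  rw [hG] at h
  have hd : (0 : ℝ) < d := by exact_mod_cast NeZero.pos d
  have hGp : 0 < Real.Gamma (n + m + d / 2) := Real.Gamma_pos_of_pos (by positivity)
  simp only [ev_mul, ev_pow, ev_linForm] at h
  rw [eq_comm, ← mul_right_inj' (half_pos hGp).ne', h]
  field_simp

lemma integral_sphere_harm_mul_linForm_pow_eq_zero [NeZero d] {ξ : E d} {n : ℕ}
    {u : MvPolynomial (Fin d) ℝ} (hu : u ∈ harm d n) {k : ℕ}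
    (hk : ∀ m, n + 2 * m ≠ k) :
    ∫ ω : S d, ev u ω.1 * (inner ℝ ξ (ω.1 : E d)) ^ k ∂(surf d) = 0 := by
  have hl := (isHomogeneous_linForm ξ).pow k
  rw [one_mul] at hl
  have hh := (mem_harm.1 hu).1.mul hl
  have h0 : gauss d (u * linForm ξ ^ k) = 0 := by
    rcases lt_or_ge k n with h | h
    · exact gauss_harm_mul_eq_zero hu h hl
    · refine gauss_eq_zero_of_odd ?_ hh
      rw [← Nat.not_even_iff_odd]
      intro he
      rw [Nat.even_iff] at he
      exact hk ((k - n) / 2) (by omega)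
  rw [gauss_eq_integral_sphere hh] at h0
  have hd : (0 : ℝ) < d := by exact_mod_cast NeZero.pos d
  have hGp : 0 < Real.Gamma ((((n + k : ℕ) : ℝ) + d) / 2) := Real.Gamma_pos_of_pos (by positivity)
  simp only [ev_mul, ev_pow, ev_linForm] at h0
  exact (mul_eq_zero.1 h0).resolve_left (half_pos hGp).ne'

/-! ### The Fourier transform of a spherical harmonic -/

lemma order_add_one (d n : ℕ) : order d n + 1 = n + d / 2 := by
  simp only [order]; ring

lemma integrable_sphere {F : Type*} [NormedAddCommGroup F] {f : S d → F} (hf : Continuous f) :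
    Integrable f (surf d) :=
  hf.integrable_of_hasCompactSupport (HasCompactSupport.of_compactSpace _)

lemma abs_inner_sphere_le {ξ : E d} (hξ : ‖ξ‖ = 1) (ω : S d) : |inner ℝ ξ (ω.1 : E d)| ≤ 1 := by
  have := abs_real_inner_le_norm ξ ω.1
  rwa [hξ, norm_sphere, one_mul] at this

/-- Expansion of the exponential and integration term by term. -/
lemma hasSum_integral_sphere_mul_exp {ξ : E d} (hξ : ‖ξ‖ = 1) {φ : S d → ℝ} (hφ : Continuous φ)
    {t : ℝ} (ht : 0 < t) :
    HasSum (fun k : ℕ => ((-Complex.I * t) ^ k / k.factorial : ℂ) *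
        ((∫ ω : S d, φ ω * (inner ℝ ξ (ω.1 : E d)) ^ k ∂(surf d) : ℝ) : ℂ))
      (∫ ω : S d, (φ ω : ℂ) *
        Complex.exp (-Complex.I * ((t * inner ℝ ξ (ω.1 : E d) : ℝ) : ℂ)) ∂(surf d)) := by
  have hl : Continuous fun ω : S d => inner ℝ ξ (ω.1 : E d) := by fun_prop
  generalize hL : (fun ω : S d => inner ℝ ξ (ω.1 : E d)) = l at hl
  have hle (ω : S d) : |l ω| ≤ 1 := by rw [← hL]; exact abs_inner_sphere_le hξ ω
  have hl' (ω : S d) : inner ℝ ξ (ω.1 : E d) = l ω := by rw [← hL]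
  simp only [hl']
  have hexp (z : ℂ) : HasSum (fun k : ℕ => z ^ k / k.factorial) (Complex.exp z) := by
    rw [Complex.exp_eq_exp_ℂ]
    exact NormedSpace.expSeries_div_hasSum_exp z
  have hint : Integrable (fun ω : S d => ∑' k : ℕ, |φ ω| * (t ^ k / k.factorial)) (surf d) := by
    simp only [tsum_mul_left]
    have hφ' : Continuous fun ω : S d => |φ ω| := hφ.abs
    exact Integrable.mul_const (integrable_sphere hφ') _
  have hF := hasSum_integral_of_dominated_convergence (μ := surf d)
    (F := fun (k : ℕ) (ω : S d) => (φ ω : ℂ) *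
      ((-Complex.I * ((t * l ω : ℝ) : ℂ)) ^ k / k.factorial))
    (f := fun ω : S d => (φ ω : ℂ) * Complex.exp (-Complex.I * ((t * l ω : ℝ) : ℂ)))
    (fun k ω => |φ ω| * (t ^ k / k.factorial))
    (fun k => Continuous.aestronglyMeasurable (by fun_prop))
    (fun k => Eventually.of_forall fun ω => by
      rw [norm_mul, norm_div, norm_pow, norm_mul, norm_neg, Complex.norm_I, one_mul,
        Complex.norm_real, Complex.norm_real, Real.norm_eq_abs, Real.norm_eq_abs, abs_mul,
        abs_of_pos ht, Complex.norm_natCast]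
      gcongr
      exact mul_le_of_le_one_right ht.le (hle ω))
    (Eventually.of_forall fun ω => (Real.summable_pow_div_factorial t).mul_left _)
    hint
    (Eventually.of_forall fun ω => (hexp _).mul_left _)
  convert! hF using 2 with k
  rw [← integral_complex_ofReal, ← integral_const_mul]
  refine integral_congr_ae (Eventually.of_forall fun ω => ?_)
  simp only
  push_cast
  ring

/-- The term of index `n + 2 m` of the exponential series is the term of index `m` of the Bessel
series. -/
lemma moment_mul_eq_bessel_term (hd : 0 < d) (n m : ℕ) {t : ℝ} (ht : 0 < t) :
    (-1 : ℝ) ^ m * t ^ (n + 2 * m) / (n + 2 * m).factorial *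
      (2 * Real.pi ^ ((d : ℝ) / 2) * (n + 2 * m).factorial /
        (2 ^ (n + 2 * m) * m.factorial * Real.Gamma (n + m + d / 2))) =
    (2 * Real.pi) ^ ((d : ℝ) / 2) / t ^ (((d : ℝ) - 2) / 2) *
      ((-1) ^ m / (m.factorial * Real.Gamma (m + order d n + 1)) *
        (t / 2) ^ (2 * (m : ℝ) + order d n)) := by
  have hG : (m : ℝ) + order d n + 1 = n + m + d / 2 := by
    rw [add_assoc, order_add_one]; ring
  have hGp : 0 < Real.Gamma (n + m + d / 2) := Real.Gamma_pos_of_pos (by positivity)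
  have hpow : (t / 2) ^ (2 * (m : ℝ) + order d n) * ((2 * Real.pi) ^ ((d : ℝ) / 2)) =
      t ^ (((d : ℝ) - 2) / 2) * (t ^ (n + 2 * m) / 2 ^ (n + 2 * m)) *
        (2 * Real.pi ^ ((d : ℝ) / 2)) := by
    have e1 : 2 * (m : ℝ) + order d n = ((d : ℝ) - 2) / 2 + ((n + 2 * m : ℕ) : ℝ) := by
      simp only [order]; push_cast; ring
    have e2 : (2 : ℝ) ^ ((d : ℝ) / 2) = 2 ^ (((d : ℝ) - 2) / 2) * 2 := by
      have := Real.rpow_add two_pos (((d : ℝ) - 2) / 2) 1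
      rw [Real.rpow_one] at this
      rw [← this]
      ring_nf
    rw [e1, Real.rpow_add (by positivity), Real.rpow_natCast, Real.div_rpow ht.le two_pos.le,
      Real.mul_rpow two_pos.le Real.pi_pos.le, div_pow, e2]
    have : (2 : ℝ) ^ (((d : ℝ) - 2) / 2) ≠ 0 := (Real.rpow_pos_of_pos two_pos _).ne'
    field_simp
  have htp : (t ^ (((d : ℝ) - 2) / 2) : ℝ) ≠ 0 := (Real.rpow_pos_of_pos ht _).ne'
  rw [hG]
  calc _ = (-1) ^ m / (m.factorial * Real.Gamma (n + m + d / 2)) / t ^ (((d : ℝ) - 2) / 2) *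
        (t ^ (((d : ℝ) - 2) / 2) * (t ^ (n + 2 * m) / 2 ^ (n + 2 * m)) *
      (2 * Real.pi ^ ((d : ℝ) / 2))) := by field_simp
    _ = _ := by rw [← hpow]; ring

/-- The Fourier transform of a spherical harmonic on the sphere: the moments of `u` vanish except in
the degrees `n + 2 m`, and those terms of the exponential series sum to the Bessel series. -/
lemma integral_sphere_harm_mul_exp [NeZero d] {ξ : E d} (hξ : ‖ξ‖ = 1) {n : ℕ}
    {u : MvPolynomial (Fin d) ℝ} (hu : u ∈ harm d n) {t : ℝ} (ht : 0 < t) :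
    ∫ ω : S d, (ev u ω.1 : ℂ) * Complex.exp (-Complex.I * ((t * inner ℝ ξ (ω.1 : E d) : ℝ) : ℂ))
        ∂(surf d) =
      (((2 * Real.pi) ^ ((d : ℝ) / 2) : ℝ) : ℂ) * (-Complex.I) ^ n /
        ((t ^ (((d : ℝ) - 2) / 2) : ℝ) : ℂ) * besselJ (order d n) t * ev u ξ := by
  have hsum := hasSum_integral_sphere_mul_exp hξ
    (φ := fun ω : S d => ev u ω.1) ((continuous_ev u).comp continuous_subtype_val) ht
  have hinj : Function.Injective fun m : ℕ => n + 2 * m := fun a b h => by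
    simpa using h
  rw [← hinj.hasSum_iff (fun k hk => by
    rw [integral_sphere_harm_mul_linForm_pow_eq_zero hu (fun m h => hk ⟨m, h⟩)]
    simp)] at hsum
  rw [← hsum.tsum_eq, besselJ, Complex.ofReal_tsum, ← tsum_mul_left, ← tsum_mul_right]
  refine tsum_congr fun m => ?_
  simp only [Function.comp_apply]
  rw [integral_sphere_harm_mul_linForm_pow hξ hu]
  have hI : (-Complex.I * t) ^ (n + 2 * m) = (-Complex.I) ^ n * ((-1) ^ m * t ^ (n + 2 * m)) := by
    rw [mul_pow, pow_add (-Complex.I), pow_mul (-Complex.I), neg_sq, Complex.I_sq]; ring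
  rw [hI]
  have hc := congrArg (fun x : ℝ => (-Complex.I) ^ n * (x : ℂ) * (ev u ξ : ℂ))
    (moment_mul_eq_bessel_term (NeZero.pos d) n m ht)
  push_cast at hc ⊢
  linear_combination hc

/-! ### Decomposition of polynomials on the sphere into harmonics -/

/-- The polynomial `|x|²`. -/
def normSqPoly (d : ℕ) : MvPolynomial (Fin d) ℝ := ∑ i, MvPolynomial.X i ^ 2

lemma ev_normSqPoly (x : E d) : ev (normSqPoly d) x = ‖x‖ ^ 2 := by
  simp [normSqPoly, EuclideanSpace.real_norm_sq_eq]

lemma isHomogeneous_normSqPoly : (normSqPoly d).IsHomogeneous 2 :=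
  MvPolynomial.IsHomogeneous.sum _ _ _ fun _ _ => by
    simpa using (MvPolynomial.isHomogeneous_X ℝ _).pow 2

lemma eq_zero_of_forall_ev {p : MvPolynomial (Fin d) ℝ} (h : ∀ x : E d, ev p x = 0) : p = 0 :=
  MvPolynomial.funext fun x => by simpa [ev] using h (WithLp.toLp 2 x)

/-- No nonzero multiple of `|x|²` is harmonic: it would be orthogonal to its own cofactor. -/
lemma eq_zero_of_normSqPoly_mul_harm [NeZero d] {m : ℕ} {q : MvPolynomial (Fin d) ℝ}
    (hq : q.IsHomogeneous m) (hl : lap d (normSqPoly d * q) = 0) : q = 0 := by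
  have hh : normSqPoly d * q ∈ harm d (2 + m) := mem_harm.2 ⟨isHomogeneous_normSqPoly.mul hq, hl⟩
  have h0 := gauss_harm_mul_eq_zero hh (by omega : m < 2 + m) hq
  have hc : Continuous fun x : E d => ev (normSqPoly d * q * q) x * Real.exp (-‖x‖ ^ 2) := by
    have := continuous_ev (normSqPoly d * q * q)
    fun_prop
  have hv : ∀ x : E d, ev (normSqPoly d * q * q) x = (‖x‖ * ev q x) ^ 2 := fun x => by
    simp only [ev_mul, ev_normSqPoly]; ring
  have hnonneg : ∀ x : E d, 0 ≤ ev (normSqPoly d * q * q) x * Real.exp (-‖x‖ ^ 2) := fun x => by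
    rw [hv]; positivity
  rw [gauss_apply, integral_eq_zero_iff_of_nonneg hnonneg (integrable_ev_mul_gaussian _)] at h0
  have h1 := (Continuous.ae_eq_iff_eq volume hc continuous_zero).1 h0
  have h2 : normSqPoly d * (q * q) = 0 := by
    refine eq_zero_of_forall_ev fun x => ?_
    have := congrFun h1 x
    simpa [mul_assoc, Real.exp_ne_zero] using this
  have h3 : normSqPoly d ≠ 0 := fun h => by
    have := congrArg (fun p => ev p (EuclideanSpace.single (0 : Fin d) (1 : ℝ))) h
    simp [ev_normSqPoly] at this
  simpa [h3] using h2

/-- `p = h + |x|² q` with `h` harmonic: `q ↦ Δ(|x|² q)` is an injective endomorphism of a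
finite-dimensional space, hence surjective. -/
lemma exists_harm_add_normSqPoly_mul [NeZero d] {m : ℕ} {p : MvPolynomial (Fin d) ℝ}
    (hp : p.IsHomogeneous (m + 2)) :
    ∃ h ∈ harm d (m + 2), ∃ q : MvPolynomial (Fin d) ℝ, q.IsHomogeneous m ∧
      p = h + normSqPoly d * q := by
  have hmul {q : MvPolynomial (Fin d) ℝ} (hq : q.IsHomogeneous m) :
      (normSqPoly d * q).IsHomogeneous (m + 2) := by
    rw [add_comm]; exact isHomogeneous_normSqPoly.mul hq
  let V := MvPolynomial.homogeneousSubmodule (Fin d) ℝ m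
  have : Module.Finite ℝ V := Module.Finite.iff_fg.2 (MvPolynomial.homogeneousSubmodule_fg _ _ m)
  let T : V →ₗ[ℝ] V :=
    (lap d ∘ₗ LinearMap.mulLeft ℝ (normSqPoly d)).restrict fun q hq => by
      simpa [V] using isHomogeneous_lap (hmul hq)
  have hT : Function.Injective T := by
    rw [← LinearMap.ker_eq_bot, LinearMap.ker_eq_bot']
    intro q hq
    have := congrArg Subtype.val hq
    exact Subtype.ext (eq_zero_of_normSqPoly_mul_harm q.2 this)
  obtain ⟨q, hq⟩ := (LinearMap.injective_iff_surjective.1 hT)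
    ⟨lap d p, by simpa [V] using isHomogeneous_lap hp⟩
  have hq' : lap d (normSqPoly d * q) = lap d p := congrArg Subtype.val hq
  refine ⟨p - normSqPoly d * q, mem_harm.2 ⟨hp.sub (hmul q.2), ?_⟩, q, q.2, by ring⟩
  rw [map_sub, hq', sub_self]

/-- A polynomial as a continuous complex function on the sphere. -/
def evC (d : ℕ) : MvPolynomial (Fin d) ℝ →ₗ[ℝ] C(S d, ℂ) where
  toFun p := ⟨fun ω => (ev p ω.1 : ℂ),
    Complex.continuous_ofReal.comp ((continuous_ev p).comp continuous_subtype_val)⟩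
  map_add' p q := by ext; simp
  map_smul' a p := by ext; simp

@[simp] lemma evC_apply (p : MvPolynomial (Fin d) ℝ) (ω : S d) : evC d p ω = (ev p ω.1 : ℂ) := rfl

/-- The function `Y_ℓ^n` on the sphere. -/
def OrthonormalHarmonics.YC (B : OrthonormalHarmonics d) (i : Σ n, Fin (dimHarm d n)) : C(S d, ℂ) :=
  evC d (B.basis i.1 i.2 : MvPolynomial (Fin d) ℝ)

lemma OrthonormalHarmonics.YC_apply (B : OrthonormalHarmonics d) (i : Σ n, Fin (dimHarm d n))
    (ω : S d) : B.YC i ω = (B.Y i.1 i.2 ω.1 : ℂ) := rfl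

lemma OrthonormalHarmonics.continuous_Y (B : OrthonormalHarmonics d) (n : ℕ)
    (l : Fin (dimHarm d n)) : Continuous (B.Y n l) := continuous_ev _

lemma evC_mem_span_of_harm (B : OrthonormalHarmonics d) {n : ℕ} {h : MvPolynomial (Fin d) ℝ}
    (hh : h ∈ harm d n) : evC d h ∈ Submodule.span ℂ (Set.range B.YC) := by
  have h1 := (B.basis n).sum_repr ⟨h, hh⟩
  have h2 : h = ∑ l, (B.basis n).repr ⟨h, hh⟩ l • (B.basis n l : MvPolynomial (Fin d) ℝ) := by
    have := congrArg Subtype.val h1.symm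
    simpa only [Submodule.coe_sum, Submodule.coe_smul] using this
  rw [h2, map_sum]
  refine Submodule.sum_mem _ fun l _ => ?_
  rw [map_smul]
  exact Submodule.smul_of_tower_mem _ _ (Submodule.subset_span ⟨⟨n, l⟩, rfl⟩)

/-- On the sphere every polynomial is a linear combination of spherical harmonics, because
`|x|² = 1` there. -/
lemma evC_mem_span [NeZero d] (B : OrthonormalHarmonics d) (p : MvPolynomial (Fin d) ℝ) :
    evC d p ∈ Submodule.span ℂ (Set.range B.YC) := by
  have key : ∀ n (p : MvPolynomial (Fin d) ℝ), p.IsHomogeneous n →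
      evC d p ∈ Submodule.span ℂ (Set.range B.YC) := by
    intro n
    induction n using Nat.strong_induction_on with
    | _ n ih =>
      intro p hp
      rcases lt_or_ge n 2 with h2 | h2
      · exact evC_mem_span_of_harm B (mem_harm.2 ⟨hp, lap_eq_zero_of_lt_two hp h2⟩)
      · obtain ⟨m, rfl⟩ : ∃ m, n = m + 2 := ⟨n - 2, by omega⟩
        obtain ⟨h, hh, q, hq, rfl⟩ := exists_harm_add_normSqPoly_mul hp
        have : evC d (normSqPoly d * q) = evC d q := by
          ext ω; simp [ev_normSqPoly]
        rw [map_add, this]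
        exact add_mem (evC_mem_span_of_harm B hh) (ih m (by omega) q hq)
  rw [← MvPolynomial.sum_homogeneousComponent p, map_sum]
  exact Submodule.sum_mem _ fun i _ => key i _ (MvPolynomial.homogeneousComponent_isHomogeneous i p)

/-! ### Spherical harmonics as a Hilbert basis -/

/-- The spherical harmonics span a dense subspace of the continuous functions, by the real
Stone–Weierstrass theorem applied to real and imaginary parts. -/
lemma topologicalClosure_span_YC [NeZero d] (B : OrthonormalHarmonics d) :
    (Submodule.span ℂ (Set.range B.YC)).topologicalClosure = ⊤ := by
  set V := (Submodule.span ℂ (Set.range B.YC)).topologicalClosure with hV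
  -- the real polynomial functions form a dense subalgebra of `C(S, ℝ)`
  let X : Fin d → C(S d, ℝ) := fun i => ⟨fun ω => ω.1 i, by fun_prop⟩
  let A : Subalgebra ℝ C(S d, ℝ) := (MvPolynomial.aeval (R := ℝ) X).range
  have hA : A.topologicalClosure = ⊤ := by
    refine ContinuousMap.subalgebra_topologicalClosure_eq_top_of_separatesPoints A ?_
    intro x y hxy
    obtain ⟨i, hi⟩ : ∃ i, x.1 i ≠ y.1 i := by
      by_contra! h
      exact hxy (Subtype.ext (PiLp.ext h))
    refine ⟨fun ω => ω.1 i, ⟨X i, ⟨MvPolynomial.X i, by simp⟩, rfl⟩, hi⟩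
  let R : C(ℝ, ℂ) := ⟨Complex.ofReal, Complex.continuous_ofReal⟩
  have hreal : ∀ f : C(S d, ℝ), R.comp f ∈ V := by
    have hclosed : IsClosed {f : C(S d, ℝ) | R.comp f ∈ V} :=
      (Submodule.isClosed_topologicalClosure _).preimage R.continuous_postcomp
    have hsub : (A : Set C(S d, ℝ)) ⊆ {f | R.comp f ∈ V} := by
      rintro _ ⟨p, rfl⟩
      refine Submodule.le_topologicalClosure _ ?_
      convert! evC_mem_span B p using 1
      ext ω
      have : (MvPolynomial.aeval X p) ω = ev p ω.1 := by
        induction p using MvPolynomial.induction_on with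
        | C a => simp [ev]
        | add p q hp hq => simp [hp, hq]
        | mul_X p i hp => simp [hp, X]
      simp [R, this]
    intro f
    have : f ∈ A.topologicalClosure := by rw [hA]; trivial
    exact closure_minimal hsub hclosed this
  rw [eq_top_iff]
  intro f _
  have hf : f = R.comp ⟨fun ω => (f ω).re, by fun_prop⟩ +
      Complex.I • R.comp ⟨fun ω => (f ω).im, by fun_prop⟩ := by
    ext ω
    simp [R, mul_comm Complex.I]
  rw [hf]
  exact V.add_mem (hreal _) (V.smul_mem _ (hreal _))

/-- The class of `Y_ℓ^n` in `L²(𝕊^{d-1}; ℂ)`. -/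
def OrthonormalHarmonics.YL (B : OrthonormalHarmonics d) (i : Σ n, Fin (dimHarm d n)) :
    Lp ℂ 2 (surf d) :=
  ContinuousMap.toLp 2 (surf d) ℂ (B.YC i)

lemma OrthonormalHarmonics.coeFn_YL (B : OrthonormalHarmonics d) (i : Σ n, Fin (dimHarm d n)) :
    B.YL i =ᵐ[surf d] fun ω => (B.Y i.1 i.2 ω.1 : ℂ) :=
  ContinuousMap.coeFn_toLp (𝕜 := ℂ) _ _

lemma OrthonormalHarmonics.inner_YL (B : OrthonormalHarmonics d) (i : Σ n, Fin (dimHarm d n))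
    (G : Lp ℂ 2 (surf d)) :
    inner ℂ (B.YL i) G = ∫ ω, G ω * (B.Y i.1 i.2 ω.1 : ℂ) ∂(surf d) := by
  rw [L2.inner_def]
  refine integral_congr_ae ?_
  filter_upwards [B.coeFn_YL i] with ω h
  rw [h]
  simp

lemma integral_sphere_harm_mul_harm [NeZero d] {n m : ℕ} (hnm : n ≠ m)
    {p q : MvPolynomial (Fin d) ℝ} (hp : p ∈ harm d n) (hq : q ∈ harm d m) :
    ∫ ω : S d, ev p ω.1 * ev q ω.1 ∂(surf d) = 0 := by
  have h0 : gauss d (p * q) = 0 := by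
    rcases hnm.lt_or_gt with h | h
    · rw [mul_comm]; exact gauss_harm_mul_eq_zero hq h (mem_harm.1 hp).1
    · exact gauss_harm_mul_eq_zero hp h (mem_harm.1 hq).1
  rw [gauss_eq_integral_sphere ((mem_harm.1 hp).1.mul (mem_harm.1 hq).1)] at h0
  have hd : (0 : ℝ) < d := by exact_mod_cast NeZero.pos d
  have hGp : 0 < Real.Gamma ((((n + m : ℕ) : ℝ) + d) / 2) := Real.Gamma_pos_of_pos (by positivity)
  simp only [ev_mul] at h0
  exact (mul_eq_zero.1 h0).resolve_left (half_pos hGp).ne'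

lemma OrthonormalHarmonics.orthonormal_YL [NeZero d] (B : OrthonormalHarmonics d) :
    Orthonormal ℂ B.YL := by
  classical
  rw [orthonormal_iff_ite]
  rintro ⟨n, l⟩ ⟨m, k⟩
  have h1 : inner ℂ (B.YL ⟨n, l⟩) (B.YL ⟨m, k⟩) =
      ((∫ ω : S d, B.Y m k ω.1 * B.Y n l ω.1 ∂(surf d) : ℝ) : ℂ) := by
    rw [B.inner_YL, ← integral_complex_ofReal]
    refine integral_congr_ae ?_
    filter_upwards [B.coeFn_YL ⟨m, k⟩] with ω h
    rw [h]
    simp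
  rw [h1]
  by_cases hnm : n = m
  · subst hnm
    have := B.orthonormal n k l
    simp only [OrthonormalHarmonics.Y] at this ⊢
    rw [this]
    by_cases hlk : l = k <;> simp [hlk, eq_comm]
  · simp only [OrthonormalHarmonics.Y]
    rw [integral_sphere_harm_mul_harm (Ne.symm hnm) (B.basis m k).2 (B.basis n l).2]
    simp [hnm]

lemma OrthonormalHarmonics.span_YL [NeZero d] (B : OrthonormalHarmonics d) :
    ⊤ ≤ (Submodule.span ℂ (Set.range B.YL)).topologicalClosure := by
  have hdense : Dense ((Submodule.span ℂ (Set.range B.YC) : Submodule ℂ C(S d, ℂ)) :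
      Set C(S d, ℂ)) := by
    rw [Submodule.dense_iff_topologicalClosure_eq_top]; exact topologicalClosure_span_YC B
  have hr := (ContinuousMap.toLp_denseRange ℂ (surf d) ℂ (p := 2) (by simp)).dense_image
    (ContinuousMap.toLp 2 (surf d) ℂ).continuous hdense
  have himg : (ContinuousMap.toLp 2 (surf d) ℂ : C(S d, ℂ) →L[ℂ] Lp ℂ 2 (surf d)) ''
      (Submodule.span ℂ (Set.range B.YC) : Submodule ℂ C(S d, ℂ)) =
      (Submodule.span ℂ (Set.range B.YL) : Submodule ℂ (Lp ℂ 2 (surf d))) := by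
    have := Submodule.map_span
      (ContinuousMap.toLp 2 (surf d) ℂ : C(S d, ℂ) →L[ℂ] Lp ℂ 2 (surf d)).toLinearMap
      (Set.range B.YC)
    rw [← Set.range_comp] at this
    exact congrArg SetLike.coe this
  rw [himg] at hr
  exact (Submodule.dense_iff_topologicalClosure_eq_top.1 hr).ge

/-- The spherical harmonics as a Hilbert basis of `L²(𝕊^{d-1}; ℂ)`. -/
def OrthonormalHarmonics.hilbertBasis [NeZero d] (B : OrthonormalHarmonics d) :
    HilbertBasis (Σ n, Fin (dimHarm d n)) ℂ (Lp ℂ 2 (surf d)) :=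
  HilbertBasis.mk B.orthonormal_YL B.span_YL

lemma OrthonormalHarmonics.hilbertBasis_apply [NeZero d] (B : OrthonormalHarmonics d)
    (i : Σ n, Fin (dimHarm d n)) : B.hilbertBasis i = B.YL i :=
  congrFun (HilbertBasis.coe_mk B.orthonormal_YL B.span_YL) i

/-- The coefficient `∫ g Y_ℓ^n dσ` of a function on the sphere. -/
def OrthonormalHarmonics.sphCoeff (B : OrthonormalHarmonics d) (g : S d → ℂ) (n : ℕ)
    (l : Fin (dimHarm d n)) : ℂ :=
  ∫ ω : S d, g ω * (B.Y n l ω.1 : ℂ) ∂(surf d)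

/-- The partial sum of degree `< N` of the expansion of `g` in spherical harmonics. -/
def OrthonormalHarmonics.partialSum (B : OrthonormalHarmonics d) (g : S d → ℂ) (N : ℕ)
    (ω : S d) : ℂ :=
  ∑ n ∈ Finset.range N, ∑ l : Fin (dimHarm d n), (B.Y n l ω.1 : ℂ) * B.sphCoeff g n l

lemma OrthonormalHarmonics.inner_YL_toLp (B : OrthonormalHarmonics d) {g : S d → ℂ}
    (hg : MemLp g 2 (surf d)) (i : Σ n, Fin (dimHarm d n)) :
    inner ℂ (B.YL i) (hg.toLp g) = B.sphCoeff g i.1 i.2 := by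
  rw [B.inner_YL, OrthonormalHarmonics.sphCoeff]
  refine integral_congr_ae ?_
  filter_upwards [hg.coeFn_toLp] with ω h
  rw [h]

lemma OrthonormalHarmonics.eLpNorm_sub_partialSum (B : OrthonormalHarmonics d) {g : S d → ℂ}
    (hg : MemLp g 2 (surf d)) (N : ℕ) :
    eLpNorm (fun ω => g ω - B.partialSum g N ω) 2 (surf d) =
      ‖hg.toLp g - ∑ n ∈ Finset.range N, ∑ l : Fin (dimHarm d n),
        B.sphCoeff g n l • B.YL ⟨n, l⟩‖ₑ := by
  let P : C(S d, ℂ) := ∑ n ∈ Finset.range N, ∑ l : Fin (dimHarm d n),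
        B.sphCoeff g n l • B.YC ⟨n, l⟩
  have hP : ContinuousMap.toLp 2 (surf d) ℂ P = ∑ n ∈ Finset.range N, ∑ l : Fin (dimHarm d n),
        B.sphCoeff g n l • B.YL ⟨n, l⟩ := by
    simp only [P, map_sum, map_smul, OrthonormalHarmonics.YL]
  rw [← hP, Lp.enorm_def]
  refine eLpNorm_congr_ae ?_
  filter_upwards [hg.coeFn_toLp, ContinuousMap.coeFn_toLp (p := 2) (𝕜 := ℂ) (surf d) P,
    Lp.coeFn_sub (hg.toLp g) (ContinuousMap.toLp 2 (surf d) ℂ P)] with ω h1 h2 h3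
  rw [h3, Pi.sub_apply, h1, h2]
  simp [P, OrthonormalHarmonics.partialSum, OrthonormalHarmonics.YC_apply, mul_comm]

/-- The expansion of an `L²` function on the sphere in spherical harmonics. -/
lemma OrthonormalHarmonics.tendsto_eLpNorm_sub_partialSum [NeZero d] (B : OrthonormalHarmonics d)
    {g : S d → ℂ} (hg : MemLp g 2 (surf d)) :
    Tendsto (fun N => eLpNorm (fun ω => g ω - B.partialSum g N ω) 2 (surf d)) atTop (𝓝 0) := by
  have h1 := B.hilbertBasis.hasSum_repr (hg.toLp g)
  simp only [HilbertBasis.repr_apply_apply, B.hilbertBasis_apply, B.inner_YL_toLp hg] at h1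
  have h2 := (h1.sigma fun n => hasSum_fintype _).tendsto_sum_nat
  have h3 := (tendsto_const_nhds (x := hg.toLp g)).sub h2
  rw [sub_self] at h3
  simp only [B.eLpNorm_sub_partialSum hg]
  simpa using h3.enorm

/-- Bessel's inequality, in the form that the remainders of the expansion are dominated by the
function. -/
lemma OrthonormalHarmonics.eLpNorm_sub_partialSum_le [NeZero d] (B : OrthonormalHarmonics d)
    {g : S d → ℂ} (hg : MemLp g 2 (surf d)) (N : ℕ) :
    eLpNorm (fun ω => g ω - B.partialSum g N ω) 2 (surf d) ≤ eLpNorm g 2 (surf d) := by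
  rw [B.eLpNorm_sub_partialSum hg, ← Lp.enorm_toLp hg]
  set G := hg.toLp g
  let s : Finset (Σ n, Fin (dimHarm d n)) := (Finset.range N).sigma fun _ => Finset.univ
  set P := ∑ n ∈ Finset.range N, ∑ l : Fin (dimHarm d n), B.sphCoeff g n l • B.YL ⟨n, l⟩ with hP
  have hPs : P = ∑ i ∈ s, inner ℂ (B.YL i) G • B.YL i := by
    rw [hP, Finset.sum_sigma]
    simp only [G, B.inner_YL_toLp hg]
  have horth : ∀ i ∈ s, inner ℂ (B.YL i) (G - P) = 0 := fun i hi => by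
    rw [inner_sub_right, hPs, B.orthonormal_YL.inner_right_sum _ hi, sub_self]
  have h0 : inner ℂ P (G - P) = 0 := by
    nth_rw 1 [hPs]
    rw [sum_inner]
    refine Finset.sum_eq_zero fun i hi => ?_
    rw [inner_smul_left, horth i hi, mul_zero]
  have hle : ‖G - P‖ ≤ ‖G‖ := by
    have h := norm_add_sq_eq_norm_sq_add_norm_sq_of_inner_eq_zero P (G - P) h0
    rw [add_sub_cancel] at h
    nlinarith [norm_nonneg G, norm_nonneg (G - P), mul_self_nonneg ‖P‖]
  exact enorm_le_iff_norm_le.2 hle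

lemma OrthonormalHarmonics.enorm_sphCoeff_le [NeZero d] (B : OrthonormalHarmonics d)
    {g : S d → ℂ} (hg : MemLp g 2 (surf d)) (n : ℕ) (l : Fin (dimHarm d n)) :
    ‖B.sphCoeff g n l‖ₑ ≤ eLpNorm g 2 (surf d) := by
  rw [← B.inner_YL_toLp hg ⟨n, l⟩, ← Lp.enorm_toLp hg, enorm_le_iff_norm_le]
  have := norm_inner_le_norm (𝕜 := ℂ) (B.YL ⟨n, l⟩) (hg.toLp g)
  rwa [B.orthonormal_YL.norm_eq_one, one_mul] at this

/-! ### Bessel functions as kernels, and radial coefficients of integrable functions -/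

/-- The constant `(2π)^{d/2} (-i)^n`. -/
def phase (d n : ℕ) : ℂ := (((2 * Real.pi) ^ ((d : ℝ) / 2) : ℝ) : ℂ) * (-Complex.I) ^ n

lemma phase_ne_zero (d n : ℕ) : phase d n ≠ 0 := by
  have : ((2 * Real.pi) ^ ((d : ℝ) / 2) : ℝ) ≠ 0 := (Real.rpow_pos_of_pos (by positivity) _).ne'
  have h : (((2 * Real.pi) ^ ((d : ℝ) / 2) : ℝ) : ℂ) ≠ 0 := by exact_mod_cast this
  exact mul_ne_zero h (pow_ne_zero _ (neg_ne_zero.2 Complex.I_ne_zero))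

lemma exists_sphere_ne_zero (B : OrthonormalHarmonics d) (n : ℕ) (l : Fin (dimHarm d n)) :
    ∃ ω : S d, B.Y n l ω.1 ≠ 0 := by
  by_contra! h
  have h1 := B.orthonormal n l l
  have h0 (ω : S d) : ev (B.basis n l : MvPolynomial (Fin d) ℝ) ω.1 = 0 := h ω
  simp [h0] at h1

/-- If there are nonzero harmonic polynomials of degree `n`, then `t^{-(d-2)/2} J_{n+(d-2)/2}(t)` is
continuous and bounded, being up to a constant the Fourier transform of a spherical harmonic. -/
lemma exists_bessel_kernel [NeZero d] (B : OrthonormalHarmonics d) (n : ℕ)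
    (l : Fin (dimHarm d n)) :
    ∃ (k : ℝ → ℂ) (C : ℝ), Continuous k ∧ (∀ t, ‖k t‖ ≤ C) ∧
      ∀ t, 0 < t → (besselJ (order d n) t : ℂ) = ((t ^ (((d : ℝ) - 2) / 2) : ℝ) : ℂ) * k t := by
  -- evaluate at a point `ξ` where `Y_ℓ^n` does not vanish, so that it can be divided out
  obtain ⟨ξ, hξ⟩ := exists_sphere_ne_zero B n l
  have hY : Continuous fun ω : S d => B.Y n l ω.1 :=
    (B.continuous_Y n l).comp continuous_subtype_val
  set K : ℝ → ℂ := fun t => ∫ ω : S d, (B.Y n l ω.1 : ℂ) *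
    Complex.exp (-Complex.I * ((t * inner ℝ ξ.1 (ω.1 : E d) : ℝ) : ℂ)) ∂(surf d) with hK
  have hnorm (t : ℝ) (ω : S d) : ‖(B.Y n l ω.1 : ℂ) *
      Complex.exp (-Complex.I * ((t * inner ℝ ξ.1 (ω.1 : E d) : ℝ) : ℂ))‖ = |B.Y n l ω.1| := by
    rw [norm_mul, Complex.norm_exp]
    simp
  have hint : Integrable (fun ω : S d => |B.Y n l ω.1|) (surf d) := integrable_sphere hY.abs
  have hKc : Continuous K := by
    refine continuous_of_dominated (bound := fun ω : S d => |B.Y n l ω.1|) (fun t => ?_)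
      (fun t => Eventually.of_forall fun ω => (hnorm t ω).le) hint
      (Eventually.of_forall fun ω => by fun_prop)
    have : Continuous fun ω : S d => (B.Y n l ω.1 : ℂ) *
      Complex.exp (-Complex.I * ((t * inner ℝ ξ.1 (ω.1 : E d) : ℝ) : ℂ)) := by fun_prop
    exact this.aestronglyMeasurable
  have hKb (t : ℝ) : ‖K t‖ ≤ ∫ ω : S d, |B.Y n l ω.1| ∂(surf d) :=
    (norm_integral_le_integral_norm _).trans_eq (integral_congr_ae
      (Eventually.of_forall fun ω => hnorm t ω))
  refine ⟨fun t => (phase d n * B.Y n l ξ.1)⁻¹ * K t,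
    ‖(phase d n * B.Y n l ξ.1)⁻¹‖ * ∫ ω : S d, |B.Y n l ω.1| ∂(surf d), by fun_prop, fun t => ?_,
    fun t ht => ?_⟩
  · rw [norm_mul]
    exact mul_le_mul_of_nonneg_left (hKb t) (norm_nonneg _)
  · have h := integral_sphere_harm_mul_exp (norm_sphere ξ) (B.basis n l).2 ht
    have hKt : K t = phase d n / ((t ^ (((d : ℝ) - 2) / 2) : ℝ) : ℂ) * besselJ (order d n) t *
      B.Y n l ξ.1 := h
    have htp : ((t ^ (((d : ℝ) - 2) / 2) : ℝ) : ℂ) ≠ 0 := by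
      exact_mod_cast (Real.rpow_pos_of_pos ht _).ne'
    have hξ' : (B.Y n l ξ.1 : ℂ) ≠ 0 := by exact_mod_cast hξ
    have := phase_ne_zero d n
    simp only [hKt]
    field_simp

lemma integrable_comp_polar [NeZero d] {F : Type*} [NormedAddCommGroup F] {f : E d → F}
    (hf : Integrable f) :
    Integrable (fun p : ℝ × S d => f (p.1 • (p.2 : E d))) ((rad d).prod (surf d)) :=
  ((measurePreserving_polar d).integrable_comp hf.aestronglyMeasurable).2 hf

/-- Integration in polar coordinates. -/
lemma integral_polar [NeZero d] {F : Type*} [NormedAddCommGroup F] [NormedSpace ℝ F]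
    {f : E d → F} (hf : Integrable f) :
    ∫ x, f x = ∫ r, ∫ ω : S d, f (r • (ω : E d)) ∂(surf d) ∂(rad d) := by
  have hP := measurePreserving_polar d
  rw [← integral_prod _ (integrable_comp_polar hf)]
  conv_lhs => rw [← hP.map_eq]
  rw [integral_map hP.measurable.aemeasurable]
  rw [hP.map_eq]; exact hf.aestronglyMeasurable

lemma coeff_eq_sphCoeff (B : OrthonormalHarmonics d) (f : E d → ℂ) (n : ℕ)
    (l : Fin (dimHarm d n)) (r : ℝ) :
    B.coeff f n l r = B.sphCoeff (fun ω => f (r • (ω : E d))) n l := rfl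

lemma exists_abs_Y_le (B : OrthonormalHarmonics d) (n : ℕ) (l : Fin (dimHarm d n)) :
    ∃ C, ∀ ω : S d, ‖(B.Y n l ω.1 : ℂ)‖ ≤ C := by
  obtain ⟨C, hC⟩ := isCompact_univ.exists_bound_of_continuousOn
    ((B.YC ⟨n, l⟩).continuous.continuousOn (s := Set.univ))
  exact ⟨C, fun ω => hC ω trivial⟩

lemma integrable_coeff [NeZero d] (B : OrthonormalHarmonics d) {f : E d → ℂ} (hf : Integrable f)
    (n : ℕ) (l : Fin (dimHarm d n)) : Integrable (B.coeff f n l) (rad d) := by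
  obtain ⟨C, hC⟩ := exists_abs_Y_le B n l
  have hc := B.continuous_Y n l
  refine Integrable.integral_prod_left
    (f := fun p : ℝ × S d => f (p.1 • (p.2 : E d)) * (B.Y n l p.2.1 : ℂ)) ?_
  refine (integrable_comp_polar hf).mul_bdd (c := C) ?_ (Eventually.of_forall fun p => hC p.2)
  exact Continuous.aestronglyMeasurable (by fun_prop)

lemma rpow_mul_rpow_eq [NeZero d] {r : ℝ} (hr : 0 < r) :
    r ^ (((d : ℝ) - 2) / 2) * r ^ ((d : ℝ) / 2) = r ^ (d - 1) := by
  have hd : 1 ≤ d := NeZero.one_le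
  rw [← Real.rpow_natCast, ← Real.rpow_add hr]
  congr 1
  push_cast [Nat.cast_sub hd]
  ring

/-- Absolute convergence of the Hankel transform of the coefficients of an integrable function. -/
lemma integrableOn_hankelIntegrand [NeZero d] (B : OrthonormalHarmonics d) (n : ℕ)
    (l : Fin (dimHarm d n)) {g : ℝ → ℂ} (hg : Integrable g (rad d)) {ρ : ℝ} (hρ : 0 < ρ) :
    IntegrableOn (hankelIntegrand d (order d n) g ρ) (Set.Ioi 0) := by
  obtain ⟨k, C, hk, hC, hJ⟩ := exists_bessel_kernel B n l
  have h1 := integrable_rad_iff.1 hg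
  have h2 : IntegrableOn (fun r => (r ^ (d - 1) • g r) *
      (((ρ ^ (((d : ℝ) - 2) / 2) : ℝ) : ℂ) * k (ρ * r))) (Set.Ioi 0) := by
    refine Integrable.mul_bdd (c := ‖((ρ ^ (((d : ℝ) - 2) / 2) : ℝ) : ℂ)‖ * C) h1 ?_
      (Eventually.of_forall fun r => ?_)
    · exact Continuous.aestronglyMeasurable (by fun_prop)
    · rw [norm_mul]
      exact mul_le_mul_of_nonneg_left (hC _) (norm_nonneg _)
  refine h2.congr_fun (fun r hr => ?_) measurableSet_Ioi
  have hr' : 0 < r := hr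
  simp only [hankelIntegrand]
  rw [hJ _ (mul_pos hρ hr'), Real.mul_rpow hρ.le hr'.le, ← rpow_mul_rpow_eq hr', Complex.real_smul]
  push_cast
  ring

/-! ### The Fourier transform of an integrable function on spheres -/

lemma continuous_fourierIntegral {f : E d → ℂ} (hf : Integrable f) :
    Continuous (fourierIntegral f) := by
  refine continuous_of_dominated (bound := fun x => ‖f x‖) (fun ξ => ?_)
    (fun ξ => Eventually.of_forall fun x => ?_) hf.norm
    (Eventually.of_forall fun x => by fun_prop)
  · exact hf.aestronglyMeasurable.mul (Continuous.aestronglyMeasurable (by fun_prop))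
  · simp [Complex.norm_exp]

/-- The coefficients of the Fourier transform on the sphere of radius `ρ` are the Hankel transforms
of the coefficients of the function. -/
lemma sphCoeff_fourierIntegral [NeZero d] (B : OrthonormalHarmonics d) {f : E d → ℂ}
    (hf : Integrable f) (n : ℕ) (l : Fin (dimHarm d n)) {ρ : ℝ} (hρ : 0 < ρ) :
    B.sphCoeff (fun ω => fourierIntegral f (ρ • (ω : E d))) n l =
      phase d n / ((ρ ^ (((d : ℝ) - 2) / 2) : ℝ) : ℂ) *
        hankelIntegral d (order d n) (B.coeff f n l) ρ := by
  have hc := B.continuous_Y n l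
  obtain ⟨C, hC⟩ := exists_abs_Y_le B n l
  have hYint : Integrable (fun ω : S d => (B.Y n l ω.1 : ℂ)) (surf d) :=
    integrable_sphere (B.YC ⟨n, l⟩).continuous
  -- integrability for the exchange of the integrals
  have hI : Integrable (fun p : S d × E d => ((B.Y n l p.1.1 : ℂ) * f p.2) *
      Complex.exp (-Complex.I * ((inner ℝ (ρ • (p.1 : E d)) p.2 : ℝ) : ℂ)))
      ((surf d).prod volume) := by
    refine (hYint.mul_prod hf).mul_bdd (c := 1) ?_ (Eventually.of_forall fun p => ?_)
    · exact Continuous.aestronglyMeasurable (by fun_prop)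
    · simp [Complex.norm_exp]
  have h1 : B.sphCoeff (fun ω => fourierIntegral f (ρ • (ω : E d))) n l =
      ∫ x : E d, ∫ ω : S d, ((B.Y n l ω.1 : ℂ) * f x) *
        Complex.exp (-Complex.I * ((inner ℝ (ρ • (ω : E d)) x : ℝ) : ℂ)) ∂(surf d) := by
    rw [← integral_integral_swap hI]
    refine integral_congr_ae (Eventually.of_forall fun ω => ?_)
    simp only [fourierIntegral]
    rw [mul_comm, ← integral_const_mul]
    refine integral_congr_ae (Eventually.of_forall fun x => ?_)
    simp only [mul_assoc]
  have hI2 := hI.integral_prod_right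
  rw [h1, integral_polar hI2, integral_rad, hankelIntegral, ← integral_const_mul]
  refine setIntegral_congr_fun measurableSet_Ioi fun r hr => ?_
  have hr' : 0 < r := hr
  have hρr : 0 < ρ * r := mul_pos hρ hr'
  have h2 (η : S d) : ∫ ω : S d, ((B.Y n l ω.1 : ℂ) * f (r • (η : E d))) *
        Complex.exp (-Complex.I * ((inner ℝ (ρ • (ω : E d)) (r • (η : E d)) : ℝ) : ℂ)) ∂(surf d) =
      (phase d n / (((ρ * r) ^ (((d : ℝ) - 2) / 2) : ℝ) : ℂ) * besselJ (order d n) (ρ * r)) *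
        (f (r • (η : E d)) * B.Y n l η.1) := by
    have h := integral_sphere_harm_mul_exp (norm_sphere η) (B.basis n l).2 hρr
    calc _ = f (r • (η : E d)) * ∫ ω : S d, (B.Y n l ω.1 : ℂ) *
          Complex.exp (-Complex.I * (((ρ * r) * inner ℝ (η : E d) (ω : E d) : ℝ) : ℂ))
            ∂(surf d) := by
          rw [← integral_const_mul]
          refine integral_congr_ae (Eventually.of_forall fun ω => ?_)
          simp only [real_inner_smul_left, real_inner_smul_right,
            real_inner_comm (η : E d) (ω : E d)]
          push_cast
          ring_nf
      _ = f (r • (η : E d)) * (phase d n / (((ρ * r) ^ (((d : ℝ) - 2) / 2) : ℝ) : ℂ) *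
          besselJ (order d n) (ρ * r) * B.Y n l η.1) := congrArg _ h
      _ = _ := by ring
  simp only [h2, integral_const_mul, hankelIntegrand, OrthonormalHarmonics.coeff,
    Complex.real_smul]
  have e1 : ((r ^ (((d : ℝ) - 2) / 2) : ℝ) : ℂ) ≠ 0 := by
    exact_mod_cast (Real.rpow_pos_of_pos hr' _).ne'
  have e2 : ((ρ ^ (((d : ℝ) - 2) / 2) : ℝ) : ℂ) ≠ 0 := by
    exact_mod_cast (Real.rpow_pos_of_pos hρ _).ne'
  rw [Real.mul_rpow hρ.le hr'.le, ← rpow_mul_rpow_eq hr']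
  push_cast
  field_simp

lemma sum_seriesTerm_eq_partialSum {B : OrthonormalHarmonics d} {g : S d → ℂ} {ρ : ℝ}
    {h : ∀ n : ℕ, Fin (dimHarm d n) → ℝ → ℂ}
    (hg : ∀ n l, B.sphCoeff g n l = phase d n / ((ρ ^ (((d : ℝ) - 2) / 2) : ℝ) : ℂ) * h n l ρ)
    (N : ℕ) (ω : S d) :
    ∑ n ∈ Finset.range N, seriesTerm B h n ρ ω.1 = B.partialSum g N ω := by
  refine Finset.sum_congr rfl fun n _ => ?_
  simp only [seriesTerm, Finset.mul_sum, hg, phase]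
  exact Finset.sum_congr rfl fun l _ => by ring

/-- The formula on every sphere, for integrable functions. -/
lemma tendsto_fourierIntegral_sphere [NeZero d] (B : OrthonormalHarmonics d) {f : E d → ℂ}
    (hf : Integrable f) {ρ : ℝ} (hρ : 0 < ρ) :
    Tendsto (fun N : ℕ => eLpNorm (fun ξ : S d => fourierIntegral f (ρ • ξ.1) -
        ∑ n ∈ Finset.range N, seriesTerm B
          (fun n l => hankelIntegral d (order d n) (B.coeff f n l)) n ρ ξ.1) 2 (surf d))
      atTop (𝓝 0) := by
  have hc : Continuous fun ω : S d => fourierIntegral f (ρ • (ω : E d)) :=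
    (continuous_fourierIntegral hf).comp (by fun_prop)
  have hm : MemLp (fun ω : S d => fourierIntegral f (ρ • (ω : E d))) 2 (surf d) :=
    hc.memLp_of_hasCompactSupport (HasCompactSupport.of_compactSpace _)
  have h := B.tendsto_eLpNorm_sub_partialSum hm
  simpa only [sum_seriesTerm_eq_partialSum (B := B)
    (h := fun n l => hankelIntegral d (order d n) (B.coeff f n l))
    (fun n l => sphCoeff_fourierIntegral B hf n l hρ)] using h

/-! ### The Fourier transform on `L²` -/

open FourierTransform in
/-- On `L¹ ∩ L²` the `L²` Fourier transform is given by the Fourier integral: both have the same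
integrals against test functions. -/
lemma fourier_toLp_ae_eq {f : E d → ℂ} (hf : MemLp f 2 volume) (hf1 : Integrable f) :
    (𝓕 (hf.toLp f) : Lp ℂ 2 (volume : Measure (E d))) =ᵐ[volume] (𝓕 f : E d → ℂ) := by
  have hcont : Continuous (𝓕 f : E d → ℂ) :=
    VectorFourier.fourierIntegral_continuous Real.continuous_fourierChar continuous_inner hf1
  refine ae_eq_of_integral_contDiff_smul_eq
    ((Lp.memLp (𝓕 (hf.toLp f) : Lp ℂ 2 (volume : Measure (E d)))).locallyIntegrable (by norm_num))
    hcont.locallyIntegrable fun g hg hgc => ?_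
  have hg₁ : HasCompactSupport (Complex.ofRealCLM ∘ g) := hgc.comp_left rfl
  have hg₂ : ContDiff ℝ (⊤ : ℕ∞) (Complex.ofRealCLM ∘ g) := by fun_prop
  let φ : SchwartzMap (E d) ℂ := hg₁.toSchwartzMap hg₂
  have hφ (x : E d) : φ x = (g x : ℂ) := rfl
  have h1 := congrArg (fun T : TemperedDistribution (E d) ℂ => T φ)
    (Lp.fourier_toTemperedDistribution_eq (hf.toLp f))
  simp only [TemperedDistribution.fourier_apply, Lp.toTemperedDistribution_apply, hφ] at h1
  have h2 := VectorFourier.integral_fourierIntegral_smul_eq_flip (μ := (volume : Measure (E d)))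
    (ν := (volume : Measure (E d))) (L := innerₗ (E d)) (f := φ) (g := f)
    Real.continuous_fourierChar continuous_inner φ.integrable hf1
  rw [flip_innerₗ] at h2
  calc ∫ x, g x • (𝓕 (hf.toLp f) : Lp ℂ 2 (volume : Measure (E d))) x
      = ∫ x, (g x : ℂ) • (𝓕 (hf.toLp f) : Lp ℂ 2 (volume : Measure (E d))) x := by simp
    _ = ∫ x, (𝓕 φ) x • (hf.toLp f) x := h1.symm
    _ = ∫ x, (𝓕 φ) x • f x := by
        refine integral_congr_ae ?_
        filter_upwards [hf.coeFn_toLp] with x hx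
        rw [hx]
    _ = ∫ x, φ x • (𝓕 f : E d → ℂ) x := h2
    _ = _ := by simp [hφ]

lemma measurableEmbedding_scale : MeasurableEmbedding (fun ξ : E d => (2 * Real.pi)⁻¹ • ξ) :=
  (Homeomorph.smulOfNeZero (2 * Real.pi)⁻¹ (by positivity)).measurableEmbedding

/-- A dilation multiplies Lebesgue measure by a finite constant. -/
lemma exists_map_scale : ∃ K : ENNReal, K ≠ ⊤ ∧
    (volume : Measure (E d)).map (fun ξ : E d => (2 * Real.pi)⁻¹ • ξ) = K • volume :=
  ⟨_, ENNReal.ofReal_ne_top, Measure.map_addHaar_smul volume (by positivity)⟩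

lemma quasiMeasurePreserving_scale :
    Measure.QuasiMeasurePreserving (fun ξ : E d => (2 * Real.pi)⁻¹ • ξ) := by
  obtain ⟨K, -, hK⟩ := exists_map_scale (d := d)
  exact ⟨measurableEmbedding_scale.measurable, hK ▸ Measure.smul_absolutelyContinuous⟩

lemma fourierL2_ae_eq {f : E d → ℂ} (hf : MemLp f 2 volume) (hf1 : Integrable f) :
    fourierL2 f hf =ᵐ[volume] fourierIntegral f := by
  have h := quasiMeasurePreserving_scale.ae_eq_comp (fourier_toLp_ae_eq hf hf1)
  filter_upwards [h] with ξ hξ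
  rw [fourierL2]
  refine hξ.trans ?_
  simp only [Function.comp_apply, Real.fourier_eq', fourierIntegral]
  refine integral_congr_ae (Eventually.of_forall fun x => ?_)
  simp only [smul_eq_mul]
  rw [mul_comm]
  congr 2
  rw [real_inner_smul_right, real_inner_comm]
  push_cast
  have : (Real.pi : ℂ) ≠ 0 := by exact_mod_cast Real.pi_ne_zero
  field_simp

lemma aestronglyMeasurable_fourierL2 {f : E d → ℂ} (hf : MemLp f 2 volume) :
    AEStronglyMeasurable (fourierL2 f hf) volume :=
  (Lp.aestronglyMeasurable _).comp_quasiMeasurePreserving quasiMeasurePreserving_scale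

/-- Plancherel's theorem, up to the constant of the normalization. -/
lemma exists_eLpNorm_fourierL2_sub : ∃ K : ENNReal, K ≠ ⊤ ∧
    ∀ (f g : E d → ℂ) (hf : MemLp f 2 volume) (hg : MemLp g 2 volume),
      eLpNorm (fun ξ => fourierL2 f hf ξ - fourierL2 g hg ξ) 2 volume =
        K * eLpNorm (fun x => f x - g x) 2 volume := by
  obtain ⟨K, hK, hmap⟩ := exists_map_scale (d := d)
  refine ⟨K ^ (1 / (2 : ENNReal)).toReal, ENNReal.rpow_ne_top_of_nonneg (by positivity) hK,
    fun f g hf hg => ?_⟩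
  set F := (FourierTransform.fourier (hf.toLp f) : Lp (α := E d) ℂ 2) with hF
  set G := (FourierTransform.fourier (hg.toLp g) : Lp (α := E d) ℂ 2) with hG
  have h1 : eLpNorm (fun ξ => fourierL2 f hf ξ - fourierL2 g hg ξ) 2 volume =
      eLpNorm (fun ξ => F ξ - G ξ) 2 (K • volume) := by
    rw [← hmap, measurableEmbedding_scale.eLpNorm_map_measure]
    rfl
  have h2 : eLpNorm (fun ξ => F ξ - G ξ) 2 volume = ‖F - G‖ₑ := by
    rw [Lp.enorm_def]
    exact eLpNorm_congr_ae (Lp.coeFn_sub F G).symm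
  have h3 : ‖F - G‖ₑ = ‖hf.toLp f - hg.toLp g‖ₑ := by
    have : F - G = FourierTransform.fourier (hf.toLp f - hg.toLp g) :=
      ((Lp.fourierTransformₗᵢ (E d) ℂ).map_sub _ _).symm
    rw [this, enorm_eq_iff_norm_eq, Lp.norm_fourier_eq]
  rw [h1, eLpNorm_smul_measure_of_ne_top (by norm_num), h2, h3, ← MemLp.toLp_sub, Lp.enorm_toLp,
    smul_eq_mul]
  rfl

lemma memLp_fourierL2 {f : E d → ℂ} (hf : MemLp f 2 volume) : MemLp (fourierL2 f hf) 2 volume := by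
  obtain ⟨K, hK, hmap⟩ := exists_map_scale (d := d)
  refine ⟨aestronglyMeasurable_fourierL2 hf, ?_⟩
  have h := Lp.memLp (FourierTransform.fourier (hf.toLp f) : Lp (α := E d) ℂ 2)
  have h1 := (h.smul_measure hK).2
  rwa [← hmap, measurableEmbedding_scale.eLpNorm_map_measure] at h1

/-! ### Square-integrable functions in polar coordinates -/

lemma eLpNorm_two_sq {α F : Type*} [MeasurableSpace α] [NormedAddCommGroup F] {μ : Measure α}
    (f : α → F) : eLpNorm f 2 μ ^ 2 = ∫⁻ x, ‖f x‖ₑ ^ 2 ∂μ := by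
  have := eLpNorm_nnreal_pow_eq_lintegral (μ := μ) (f := f) (p := 2) two_ne_zero
  simpa using this

lemma tendsto_zero_of_sq {ι : Type*} {l : Filter ι} {u : ι → ENNReal}
    (h : Tendsto (fun i => u i ^ 2) l (𝓝 0)) : Tendsto u l (𝓝 0) := by
  have := h.ennrpow_const (1 / 2 : ℝ)
  rw [ENNReal.zero_rpow_of_pos (by norm_num)] at this
  refine this.congr fun i => ?_
  rw [← ENNReal.rpow_natCast, ← ENNReal.rpow_mul]
  simp

lemma aestronglyMeasurable_comp_polar [NeZero d] {f : E d → ℂ}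
    (hf : AEStronglyMeasurable f volume) :
    AEStronglyMeasurable (fun p : ℝ × S d => f (p.1 • (p.2 : E d))) ((rad d).prod (surf d)) :=
  hf.comp_quasiMeasurePreserving (measurePreserving_polar d).quasiMeasurePreserving

lemma eLpNorm_polar [NeZero d] {f : E d → ℂ} (hf : AEStronglyMeasurable f volume) :
    eLpNorm f 2 volume ^ 2 =
      ∫⁻ r, eLpNorm (fun ω : S d => f (r • (ω : E d))) 2 (surf d) ^ 2 ∂(rad d) := by
  have h := eLpNorm_comp_measurePreserving (p := 2) hf (measurePreserving_polar d)
  rw [← h, eLpNorm_two_sq]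
  simp only [eLpNorm_two_sq]
  exact lintegral_prod _ ((aestronglyMeasurable_comp_polar hf).enorm.pow_const 2)

lemma aemeasurable_eLpNorm_slice_sq [NeZero d] {f : E d → ℂ}
    (hf : AEStronglyMeasurable f volume) :
    AEMeasurable (fun r => eLpNorm (fun ω : S d => f (r • (ω : E d))) 2 (surf d) ^ 2) (rad d) := by
  simp only [eLpNorm_two_sq]
  exact ((aestronglyMeasurable_comp_polar hf).enorm.pow_const 2).lintegral_prod_right'

lemma ae_memLp_slice [NeZero d] {f : E d → ℂ} (hf : MemLp f 2 volume) :
    ∀ᵐ r ∂(rad d), MemLp (fun ω : S d => f (r • (ω : E d))) 2 (surf d) := by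
  have h1 := (aestronglyMeasurable_comp_polar hf.1).prodMk_left
  have h2 : ∀ᵐ r ∂(rad d), eLpNorm (fun ω : S d => f (r • (ω : E d))) 2 (surf d) ^ 2 < ⊤ := by
    refine ae_lt_top' (aemeasurable_eLpNorm_slice_sq hf.1) ?_
    rw [← eLpNorm_polar hf.1]
    exact ENNReal.pow_ne_top hf.2.ne
  filter_upwards [h1, h2] with r h1 h2
  refine ⟨h1, ?_⟩
  by_contra h
  rw [not_lt_top_iff.1 h] at h2
  simp at h2

lemma ae_coeff_congr [NeZero d] (B : OrthonormalHarmonics d) {f g : E d → ℂ}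
    (h : f =ᵐ[volume] g) :
    ∀ᵐ r ∂(rad d), ∀ n l, B.coeff f n l r = B.coeff g n l r := by
  have h1 := (measurePreserving_polar d).quasiMeasurePreserving.ae_eq_comp h
  filter_upwards [Measure.ae_ae_of_ae_prod h1] with r hr n l
  refine integral_congr_ae ?_
  filter_upwards [hr] with ω hω
  simp only [Function.comp_apply] at hω
  rw [hω]

lemma aestronglyMeasurable_coeff [NeZero d] (B : OrthonormalHarmonics d) {f : E d → ℂ}
    (hf : AEStronglyMeasurable f volume) (n : ℕ) (l : Fin (dimHarm d n)) :
    AEStronglyMeasurable (B.coeff f n l) (rad d) := by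
  have hc := B.continuous_Y n l
  refine AEStronglyMeasurable.integral_prod_right'
    (f := fun p : ℝ × S d => f (p.1 • (p.2 : E d)) * (B.Y n l p.2.1 : ℂ)) ?_
  exact (aestronglyMeasurable_comp_polar hf).mul (Continuous.aestronglyMeasurable (by fun_prop))

/-- Taking radial coefficients is a contraction on `L²`. -/
lemma eLpNorm_coeff_le [NeZero d] (B : OrthonormalHarmonics d) {f : E d → ℂ}
    (hf : MemLp f 2 volume) (n : ℕ) (l : Fin (dimHarm d n)) :
    eLpNorm (B.coeff f n l) 2 (rad d) ≤ eLpNorm f 2 volume := by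
  have h : eLpNorm (B.coeff f n l) 2 (rad d) ^ 2 ≤ eLpNorm f 2 volume ^ 2 := by
    rw [eLpNorm_two_sq, eLpNorm_polar hf.1]
    refine lintegral_mono_ae ?_
    filter_upwards [ae_memLp_slice hf] with r hr
    exact pow_le_pow_left' (B.enorm_sphCoeff_le hr n l) 2
  exact (ENNReal.pow_le_pow_left_iff two_ne_zero).1 h

lemma ae_coeff_sub [NeZero d] (B : OrthonormalHarmonics d) {f g : E d → ℂ}
    (hf : MemLp f 2 volume) (hg : MemLp g 2 volume) (n : ℕ) (l : Fin (dimHarm d n)) :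
    ∀ᵐ r ∂(rad d), B.coeff (fun x => f x - g x) n l r = B.coeff f n l r - B.coeff g n l r := by
  have hY : MemLp (fun ω : S d => (B.Y n l ω.1 : ℂ)) 2 (surf d) :=
    (B.YC ⟨n, l⟩).continuous.memLp_of_hasCompactSupport (HasCompactSupport.of_compactSpace _)
  filter_upwards [ae_memLp_slice hf, ae_memLp_slice hg] with r h1 h2
  simp only [OrthonormalHarmonics.coeff]
  refine Eq.trans (integral_congr_ae (Eventually.of_forall fun ω => sub_mul _ _ _))
    (integral_sub (h1.integrable_mul hY) (h2.integrable_mul hY))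

/-- The norm pulls back null sets of `r^{d-1} dr` to null sets, so that radial functions may be
changed almost everywhere. -/
lemma quasiMeasurePreserving_norm [NeZero d] :
    Measure.QuasiMeasurePreserving (fun x : E d => ‖x‖) volume (rad d) := by
  refine ⟨measurable_norm, ?_⟩
  have hP := measurePreserving_polar d
  rw [← hP.map_eq, Measure.map_map measurable_norm hP.measurable]
  have h : ((fun x : E d => ‖x‖) ∘ fun p : ℝ × S d => p.1 • (p.2 : E d)) =ᵐ[(rad d).prod (surf d)]
      Prod.fst := by
    have := Measure.quasiMeasurePreserving_fst (μ := rad d) (ν := surf d)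
    filter_upwards [this.ae (ae_rad_of_pos (p := fun r => 0 < r) fun _ h => h)] with p hp
    exact norm_smul_sphere hp p.2
  rw [Measure.map_congr h]
  exact Measure.quasiMeasurePreserving_fst.absolutelyContinuous

lemma aestronglyMeasurable_seriesTerm [NeZero d] (B : OrthonormalHarmonics d)
    {h : ∀ n : ℕ, Fin (dimHarm d n) → ℝ → ℂ}
    (hh : ∀ n l, AEStronglyMeasurable (h n l) (rad d)) (n : ℕ) :
    AEStronglyMeasurable (fun ξ : E d => seriesTerm B h n ‖ξ‖ (‖ξ‖⁻¹ • ξ)) volume := by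
  have hY (l) : Measurable (B.Y n l) := (B.continuous_Y n l).measurable
  have h1 (l) : AEStronglyMeasurable (fun ξ : E d => h n l ‖ξ‖) volume :=
    (hh n l).comp_quasiMeasurePreserving quasiMeasurePreserving_norm
  have h2 (l) : AEStronglyMeasurable (fun ξ : E d => (B.Y n l (‖ξ‖⁻¹ • ξ) : ℂ)) volume := by
    refine Measurable.aestronglyMeasurable ?_
    exact Complex.measurable_ofReal.comp ((hY l).comp (by fun_prop))
  refine AEStronglyMeasurable.mul (Measurable.aestronglyMeasurable (by fun_prop)) ?_
  exact Finset.aestronglyMeasurable_fun_sum _ fun l _ => (h2 l).mul (h1 l)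

/-- The expansion of a square-integrable function into its radial coefficients times spherical
harmonics converges in `L²(ℝ^d)`: it does so on almost every sphere, and the remainders are
dominated by the function. -/
lemma tendsto_eLpNorm_sub_seriesTerm [NeZero d] (B : OrthonormalHarmonics d) {G : E d → ℂ}
    (hG : MemLp G 2 volume) {h : ∀ n : ℕ, Fin (dimHarm d n) → ℝ → ℂ}
    (hh : ∀ n l, AEStronglyMeasurable (h n l) (rad d))
    (hGh : ∀ n l, ∀ᵐ ρ ∂(rad d), B.coeff G n l ρ =
      phase d n / ((ρ ^ (((d : ℝ) - 2) / 2) : ℝ) : ℂ) * h n l ρ) :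
    Tendsto (fun N : ℕ => eLpNorm (fun ξ : E d => G ξ -
      ∑ n ∈ Finset.range N, seriesTerm B h n ‖ξ‖ (‖ξ‖⁻¹ • ξ)) 2 volume) atTop (𝓝 0) := by
  have hm (N : ℕ) : AEStronglyMeasurable (fun ξ : E d => G ξ -
      ∑ n ∈ Finset.range N, seriesTerm B h n ‖ξ‖ (‖ξ‖⁻¹ • ξ)) volume :=
    hG.1.sub (Finset.aestronglyMeasurable_fun_sum _ fun n _ =>
      aestronglyMeasurable_seriesTerm B hh n)
  have hslice : ∀ᵐ ρ ∂(rad d), ∀ N : ℕ,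
      eLpNorm (fun ω : S d => G (ρ • (ω : E d)) - ∑ n ∈ Finset.range N,
        seriesTerm B h n ‖ρ • (ω : E d)‖ (‖ρ • (ω : E d)‖⁻¹ • ρ • (ω : E d))) 2 (surf d) =
      eLpNorm (fun ω : S d => G (ρ • (ω : E d)) -
        B.partialSum (fun ω => G (ρ • (ω : E d))) N ω) 2 (surf d) := by
    have hall : ∀ᵐ ρ ∂(rad d), ∀ n l, B.coeff G n l ρ =
        phase d n / ((ρ ^ (((d : ℝ) - 2) / 2) : ℝ) : ℂ) * h n l ρ := by
      simpa only [ae_all_iff] using hGh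
    filter_upwards [hall, ae_rad_of_pos (p := fun r => 0 < r) fun _ h => h] with ρ h1 hρ N
    congr 1
    ext ω
    rw [norm_smul_sphere hρ, smul_smul, inv_mul_cancel₀ hρ.ne', one_smul,
      sum_seriesTerm_eq_partialSum (g := fun ω => G (ρ • (ω : E d))) h1]
  refine tendsto_zero_of_sq ?_
  simp only [eLpNorm_polar (hm _)]
  have hlim : ∀ᵐ ρ ∂(rad d), Tendsto (fun N : ℕ => eLpNorm (fun ω : S d => G (ρ • (ω : E d)) -
      ∑ n ∈ Finset.range N,
        seriesTerm B h n ‖ρ • (ω : E d)‖ (‖ρ • (ω : E d)‖⁻¹ • ρ • (ω : E d))) 2 (surf d) ^ 2)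
      atTop (𝓝 0) := by
    filter_upwards [hslice, ae_memLp_slice hG] with ρ h1 h2
    simp only [h1]
    have := ENNReal.Tendsto.pow (n := 2) (B.tendsto_eLpNorm_sub_partialSum h2)
    rwa [zero_pow two_ne_zero] at this
  have hle (N : ℕ) : ∀ᵐ ρ ∂(rad d), eLpNorm (fun ω : S d => G (ρ • (ω : E d)) -
      ∑ n ∈ Finset.range N,
        seriesTerm B h n ‖ρ • (ω : E d)‖ (‖ρ • (ω : E d)‖⁻¹ • ρ • (ω : E d))) 2 (surf d) ^ 2 ≤
      eLpNorm (fun ω : S d => G (ρ • (ω : E d))) 2 (surf d) ^ 2 := by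
    filter_upwards [hslice, ae_memLp_slice hG] with ρ h1 h2
    rw [h1 N, (ENNReal.pow_le_pow_left_iff two_ne_zero)]
    exact B.eLpNorm_sub_partialSum_le h2 N
  have hfin : ∫⁻ ρ, eLpNorm (fun ω : S d => G (ρ • (ω : E d))) 2 (surf d) ^ 2 ∂(rad d) ≠ ⊤ := by
    rw [← eLpNorm_polar hG.1]
    exact ENNReal.pow_ne_top hG.2.ne
  have := tendsto_lintegral_of_dominated_convergence'
      (fun r => eLpNorm (fun ω : S d => G (r • (ω : E d))) 2 (surf d) ^ 2)
      (fun N => aemeasurable_eLpNorm_slice_sq (hm N)) hle hfin hlim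
  rwa [lintegral_zero] at this

/-! ### The Hankel transform on `L²` -/

lemma radial_eq_rad_two : radial = rad 2 := by
  simp [radial, rad]

lemma ae_radial_iff {d : ℕ} {p : ℝ → Prop} : (∀ᵐ r ∂radial, p r) ↔ ∀ᵐ r ∂(rad d), p r := by
  rw [radial_eq_rad_two, ae_rad_iff, ae_rad_iff]

lemma radial_absolutelyContinuous (d : ℕ) : radial ≪ rad d := by
  refine Measure.AbsolutelyContinuous.mk fun s _ hs => ?_
  rw [← compl_compl s, ← mem_ae_iff] at hs ⊢
  exact ae_radial_iff.2 hs

lemma rad_absolutelyContinuous (d : ℕ) : rad d ≪ radial := by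
  refine Measure.AbsolutelyContinuous.mk fun s _ hs => ?_
  rw [← compl_compl s, ← mem_ae_iff] at hs ⊢
  exact ae_radial_iff.1 hs

/-- Multiplication by `ρ^{(d-2)/2}` is isometric from `L²(ρ^{d-1} dρ)` to `L²(ρ dρ)`. -/
lemma eLpNorm_rpow_mul_radial [NeZero d] (u : ℝ → ℂ) :
    eLpNorm (fun ρ => ((ρ ^ (((d : ℝ) - 2) / 2) : ℝ) : ℂ) * u ρ) 2 radial =
      eLpNorm u 2 (rad d) := by
  have h : eLpNorm (fun ρ => ((ρ ^ (((d : ℝ) - 2) / 2) : ℝ) : ℂ) * u ρ) 2 radial ^ 2 =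
      eLpNorm u 2 (rad d) ^ 2 := by
    rw [eLpNorm_two_sq, eLpNorm_two_sq, radial, rad,
      lintegral_withDensity_eq_lintegral_mul_non_measurable _ (by fun_prop) (by simp),
      lintegral_withDensity_eq_lintegral_mul_non_measurable _ (by fun_prop) (by simp)]
    refine setLIntegral_congr_fun measurableSet_Ioi fun ρ hρ => ?_
    have hρ' : 0 < ρ := hρ
    have hp := Real.rpow_pos_of_pos hρ' (((d : ℝ) - 2) / 2)
    simp only [Pi.mul_apply, enorm_mul, mul_pow, ← mul_assoc]
    congr 1
    have e1 : ‖((ρ ^ (((d : ℝ) - 2) / 2) : ℝ) : ℂ)‖ₑ =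
        ENNReal.ofReal (ρ ^ (((d : ℝ) - 2) / 2)) := by
      rw [← ofReal_norm, Complex.norm_real, Real.norm_of_nonneg hp.le]
    rw [e1, ← ENNReal.ofReal_pow hp.le, ← ENNReal.ofReal_mul hρ'.le]
    congr 1
    have e2 : ρ * ρ ^ (((d : ℝ) - 2) / 2) = ρ ^ ((d : ℝ) / 2) := by
      rw [← Real.rpow_one_add' hρ'.le]
      · ring_nf
      · have : (0 : ℝ) < d := by exact_mod_cast NeZero.pos d
        intro h; linarith
    rw [pow_two, ← mul_assoc, e2, mul_comm, rpow_mul_rpow_eq hρ']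
  exact le_antisymm ((ENNReal.pow_le_pow_left_iff two_ne_zero).1 h.le)
    ((ENNReal.pow_le_pow_left_iff two_ne_zero).1 h.ge)

lemma IsHankelTransform.ae_eq {ν : ℝ} {g h₁ h₂ : ℝ → ℂ}
    (hm : ∀ R : ℝ, AEStronglyMeasurable (hankelIntegral d ν ((Set.Iio R).indicator g)) radial)
    (H₁ : IsHankelTransform d ν g h₁) (H₂ : IsHankelTransform d ν g h₂) : h₁ =ᵐ[radial] h₂ := by
  have hle (R : ℝ) : eLpNorm (fun ρ => h₁ ρ - h₂ ρ) 2 radial ≤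
      eLpNorm (fun ρ => hankelIntegral d ν ((Set.Iio R).indicator g) ρ - h₂ ρ) 2 radial +
      eLpNorm (fun ρ => hankelIntegral d ν ((Set.Iio R).indicator g) ρ - h₁ ρ) 2 radial := by
    have := eLpNorm_sub_le (p := 2) ((hm R).sub H₂.1.1) ((hm R).sub H₁.1.1) (by norm_num)
    refine le_trans (le_of_eq ?_) this
    congr 1
    ext ρ
    simp
  have h0 : eLpNorm (fun ρ => h₁ ρ - h₂ ρ) 2 radial = 0 := by
    have := ge_of_tendsto' (H₂.2.add H₁.2) hle
    simpa using this
  have h0 := (eLpNorm_eq_zero_iff (H₁.1.1.sub H₂.1.1) (by norm_num)).1 h0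
  filter_upwards [h0] with ρ hρ
  exact sub_eq_zero.1 hρ

/-- Truncations of a square-integrable function to balls converge to it. -/
lemma tendsto_eLpNorm_indicator_ball_sub {f : E d → ℂ} (hf : MemLp f 2 volume) :
    Tendsto (fun R : ℝ => eLpNorm (fun x => (Metric.ball 0 R).indicator f x - f x) 2 volume)
      atTop (𝓝 0) := by
  refine tendsto_zero_of_sq ?_
  simp only [eLpNorm_two_sq]
  rw [← lintegral_zero (μ := (volume : Measure (E d)))]
  refine tendsto_lintegral_filter_of_dominated_convergence' (fun x => ‖f x‖ₑ ^ 2)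
    (Eventually.of_forall fun R =>
      ((hf.1.indicator measurableSet_ball).sub hf.1).enorm.pow_const 2)
    (Eventually.of_forall fun R => Eventually.of_forall fun x => ?_) ?_
    (Eventually.of_forall fun x => ?_)
  · by_cases hx : x ∈ Metric.ball (0 : E d) R <;> simp [hx]
  · rw [← eLpNorm_two_sq]
    exact ENNReal.pow_ne_top hf.2.ne
  · refine tendsto_const_nhds.congr' ?_
    filter_upwards [eventually_gt_atTop ‖x‖] with R hR
    simp [hR]

lemma memLp_truncation {f : E d → ℂ} (hf : MemLp f 2 volume) (R : ℝ) :
    MemLp ((Metric.ball 0 R).indicator f) 2 volume :=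
  hf.indicator measurableSet_ball

lemma integrable_truncation {f : E d → ℂ} (hf : MemLp f 2 volume) (R : ℝ) :
    Integrable ((Metric.ball 0 R).indicator f) := by
  have : IsFiniteMeasure ((volume : Measure (E d)).restrict (Metric.ball 0 R)) :=
    ⟨by rw [Measure.restrict_apply_univ]; exact measure_ball_lt_top⟩
  rw [integrable_indicator_iff measurableSet_ball]
  exact (hf.restrict (Metric.ball 0 R)).integrable (by norm_num)

lemma coeff_truncation (B : OrthonormalHarmonics d) (f : E d → ℂ) (n : ℕ)
    (l : Fin (dimHarm d n)) (R : ℝ) {r : ℝ} (hr : 0 < r) :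
    B.coeff ((Metric.ball 0 R).indicator f) n l r =
      (Set.Iio R).indicator (B.coeff f n l) r := by
  have hmem (ω : S d) : r • (ω : E d) ∈ Metric.ball (0 : E d) R ↔ r < R := by
    rw [mem_ball_zero_iff, norm_smul_sphere hr]
  by_cases h : r < R <;> simp [OrthonormalHarmonics.coeff, hmem, h]

/-- For a function truncated to a ball the Hankel transforms are Lebesgue integrals, and give the
coefficients of the Fourier transform. -/
lemma ae_coeff_fourierL2_truncation [NeZero d] (B : OrthonormalHarmonics d) {f : E d → ℂ}
    (hf : MemLp f 2 volume) (n : ℕ) (l : Fin (dimHarm d n)) (R : ℝ) :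
    ∀ᵐ ρ ∂(rad d), B.coeff (fourierL2 _ (memLp_truncation hf R)) n l ρ =
      phase d n / ((ρ ^ (((d : ℝ) - 2) / 2) : ℝ) : ℂ) *
        hankelIntegral d (order d n) ((Set.Iio R).indicator (B.coeff f n l)) ρ := by
  have hi := integrable_truncation hf R
  filter_upwards [ae_coeff_congr B (fourierL2_ae_eq (memLp_truncation hf R) hi),
    ae_rad_of_pos (p := fun r => 0 < r) fun _ h => h] with ρ h1 hρ
  rw [h1, coeff_eq_sphCoeff, sphCoeff_fourierIntegral B hi n l hρ]
  congr 1
  refine setIntegral_congr_fun measurableSet_Ioi fun r hr => ?_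
  simp only [hankelIntegrand]
  rw [coeff_truncation B f n l R hr]

/-- The `L²` Hankel transform of `f_ℓ^n`, read off from the coefficients of the Fourier transform
of `f`. -/
def hankelL2 (B : OrthonormalHarmonics d) {f : E d → ℂ} (hf : MemLp f 2 volume) (n : ℕ)
    (l : Fin (dimHarm d n)) (ρ : ℝ) : ℂ :=
  ((ρ ^ (((d : ℝ) - 2) / 2) : ℝ) : ℂ) * ((phase d n)⁻¹ * B.coeff (fourierL2 f hf) n l ρ)

lemma aestronglyMeasurable_radial_iff {u : ℝ → ℂ} :
    AEStronglyMeasurable u radial ↔ AEStronglyMeasurable u (rad d) :=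
  ⟨fun h => h.mono_ac (rad_absolutelyContinuous d),
    fun h => h.mono_ac (radial_absolutelyContinuous d)⟩

lemma memLp_hankelL2 [NeZero d] (B : OrthonormalHarmonics d) {f : E d → ℂ}
    (hf : MemLp f 2 volume) (n : ℕ) (l : Fin (dimHarm d n)) :
    MemLp (hankelL2 B hf n l) 2 radial := by
  have hm := aestronglyMeasurable_coeff B (aestronglyMeasurable_fourierL2 hf) n l
  refine ⟨aestronglyMeasurable_radial_iff.2 (AEStronglyMeasurable.mul
    (Measurable.aestronglyMeasurable (by fun_prop)) (hm.const_mul _)), ?_⟩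
  have h : MemLp (B.coeff (fourierL2 f hf) n l) 2 (rad d) :=
    ⟨hm, (eLpNorm_coeff_le B (memLp_fourierL2 hf) n l).trans_lt (memLp_fourierL2 hf).2⟩
  have := eLpNorm_rpow_mul_radial (d := d)
    (fun ρ => (phase d n)⁻¹ * B.coeff (fourierL2 f hf) n l ρ)
  exact this.trans_lt (h.const_mul _).2

lemma ae_hankelIntegral_truncation [NeZero d] (B : OrthonormalHarmonics d) {f : E d → ℂ}
    (hf : MemLp f 2 volume) (n : ℕ) (l : Fin (dimHarm d n)) (R : ℝ) :
    hankelIntegral d (order d n) ((Set.Iio R).indicator (B.coeff f n l)) =ᵐ[radial]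
      hankelL2 B (memLp_truncation hf R) n l := by
  refine (ae_radial_iff (d := d)).2 ?_
  filter_upwards [ae_coeff_fourierL2_truncation B hf n l R,
    ae_rad_of_pos (p := fun r => 0 < r) fun _ h => h] with ρ h1 hρ
  have e1 : ((ρ ^ (((d : ℝ) - 2) / 2) : ℝ) : ℂ) ≠ 0 := by
    exact_mod_cast (Real.rpow_pos_of_pos hρ _).ne'
  have := phase_ne_zero d n
  rw [hankelL2, h1]
  field_simp

/-- Existence of the `L²` Hankel transforms: by Plancherel's theorem the truncated integrals
converge. -/
lemma isHankelTransform_hankelL2 [NeZero d] (B : OrthonormalHarmonics d) {f : E d → ℂ}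
    (hf : MemLp f 2 volume) (n : ℕ) (l : Fin (dimHarm d n)) :
    IsHankelTransform d (order d n) (B.coeff f n l) (hankelL2 B hf n l) := by
  refine ⟨memLp_hankelL2 B hf n l, ?_⟩
  obtain ⟨K, hK, hKsub⟩ := exists_eLpNorm_fourierL2_sub (d := d)
  have hle (R : ℝ) : eLpNorm (fun ρ => hankelIntegral d (order d n)
      ((Set.Iio R).indicator (B.coeff f n l)) ρ - hankelL2 B hf n l ρ) 2 radial ≤
      ‖(phase d n)⁻¹‖ₑ * (K *
        eLpNorm (fun x => (Metric.ball 0 R).indicator f x - f x) 2 volume) := by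
    have hG := memLp_fourierL2 hf
    have hGR := memLp_fourierL2 (memLp_truncation hf R)
    have hae : (fun ρ => hankelIntegral d (order d n)
        ((Set.Iio R).indicator (B.coeff f n l)) ρ - hankelL2 B hf n l ρ) =ᵐ[radial]
        fun ρ => ((ρ ^ (((d : ℝ) - 2) / 2) : ℝ) : ℂ) * ((phase d n)⁻¹ •
          B.coeff (fun ξ => fourierL2 _ (memLp_truncation hf R) ξ - fourierL2 f hf ξ) n l) ρ := by
      filter_upwards [ae_hankelIntegral_truncation B hf n l R,
        ae_radial_iff.2 (ae_coeff_sub B hGR hG n l)] with ρ h1 h2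
      simp only [Pi.smul_apply, smul_eq_mul]
      rw [h1, h2]
      simp only [hankelL2]
      ring
    rw [eLpNorm_congr_ae hae, eLpNorm_rpow_mul_radial, eLpNorm_const_smul, ← hKsub _ _ _ hf]
    gcongr
    exact eLpNorm_coeff_le B (hGR.sub hG) n l
  have hlim := (ENNReal.Tendsto.const_mul (ENNReal.Tendsto.const_mul
    (tendsto_eLpNorm_indicator_ball_sub hf) (Or.inr hK)) (Or.inr enorm_ne_top) :
      Tendsto (fun R : ℝ => ‖(phase d n)⁻¹‖ₑ * (K *
        eLpNorm (fun x => (Metric.ball 0 R).indicator f x - f x) 2 volume)) atTop _)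
  rw [mul_zero, mul_zero] at hlim
  exact tendsto_of_tendsto_of_tendsto_of_le_of_le tendsto_const_nhds hlim (fun _ => zero_le) hle

/-- The formula in `L²(ℝ^d)`. -/
lemma tendsto_fourierL2_sub [NeZero d] (B : OrthonormalHarmonics d) {f : E d → ℂ}
    (hf : MemLp f 2 volume) {h : ∀ n : ℕ, Fin (dimHarm d n) → ℝ → ℂ}
    (hh : ∀ n l, IsHankelTransform d (order d n) (B.coeff f n l) (h n l)) :
    Tendsto (fun N : ℕ => eLpNorm (fun ξ : E d => fourierL2 f hf ξ -
      ∑ n ∈ Finset.range N, seriesTerm B h n ‖ξ‖ (‖ξ‖⁻¹ • ξ)) 2 volume) atTop (𝓝 0) := by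
  refine tendsto_eLpNorm_sub_seriesTerm B (memLp_fourierL2 hf)
    (fun n l => aestronglyMeasurable_radial_iff.1 (hh n l).1.1) fun n l => ?_
  have huniq := (hh n l).ae_eq (fun R => (memLp_hankelL2 B (memLp_truncation hf R) n l).1.congr
    (ae_hankelIntegral_truncation B hf n l R).symm) (isHankelTransform_hankelL2 B hf n l)
  filter_upwards [ae_radial_iff.1 huniq, ae_rad_of_pos (p := fun r => 0 < r) fun _ h => h]
    with ρ h1 hρ
  have e1 : ((ρ ^ (((d : ℝ) - 2) / 2) : ℝ) : ℂ) ≠ 0 := by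
    exact_mod_cast (Real.rpow_pos_of_pos hρ _).ne'
  have := phase_ne_zero d n
  rw [h1, hankelL2]
  field_simp

end FourierHankel

end

theorem mainTheorem8 (d : ℕ) (hd : 1 ≤ d) (B : FourierHankel.OrthonormalHarmonics d)
    (f : FourierHankel.E d → ℂ) (hf : MemLp f 2 volume) :
    -- the `L²` Hankel transforms of all the radial coefficients exist
    (∀ (n : ℕ) (l : Fin (FourierHankel.dimHarm d n)), ∃ h : ℝ → ℂ,
      FourierHankel.IsHankelTransform d (FourierHankel.order d n) (B.coeff f n l) h) ∧
    -- the formula, with convergence of the series in `L²(ℝ^d)`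
    (∀ h : ∀ n : ℕ, Fin (FourierHankel.dimHarm d n) → ℝ → ℂ,
      (∀ (n : ℕ) (l : Fin (FourierHankel.dimHarm d n)),
        FourierHankel.IsHankelTransform d (FourierHankel.order d n) (B.coeff f n l) (h n l)) →
      Filter.Tendsto
        (fun N : ℕ => eLpNorm
          (fun ξ : FourierHankel.E d => FourierHankel.fourierL2 f hf ξ -
            ∑ n ∈ Finset.range N, FourierHankel.seriesTerm B h n ‖ξ‖ (‖ξ‖⁻¹ • ξ)) 2 volume)
        Filter.atTop (nhds 0)) ∧
    -- if `f` is also integrable: the formula with all transforms given by absolutely convergent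
    -- integrals, for every radius `ρ > 0`, with convergence of the series in `L²(𝕊^{d-1})`
    (Integrable f volume → ∀ ρ : ℝ, 0 < ρ →
      (∀ (n : ℕ) (l : Fin (FourierHankel.dimHarm d n)),
        IntegrableOn
          (FourierHankel.hankelIntegrand d (FourierHankel.order d n) (B.coeff f n l) ρ)
          (Set.Ioi 0) volume) ∧
      Filter.Tendsto
        (fun N : ℕ => eLpNorm
          (fun ξ : FourierHankel.S d => FourierHankel.fourierIntegral f (ρ • ξ.1) -
            ∑ n ∈ Finset.range N, FourierHankel.seriesTerm B
              (fun n l => FourierHankel.hankelIntegral d (FourierHankel.order d n)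
                (B.coeff f n l)) n ρ ξ.1) 2 (FourierHankel.surf d))
        Filter.atTop (nhds 0)) := by

  have : NeZero d := ⟨by omega⟩
  refine ⟨fun n l => ⟨_, FourierHankel.isHankelTransform_hankelL2 B hf n l⟩,
    fun h hh => FourierHankel.tendsto_fourierL2_sub B hf hh, fun hf1 ρ hρ => ⟨fun n l => ?_, ?_⟩⟩
  · exact FourierHankel.integrableOn_hankelIntegrand B n l
      (FourierHankel.integrable_coeff B hf1 n l) hρ
  · exact FourierHankel.tendsto_fourierIntegral_sphere B hf1 hρ
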